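/- **Setting.** Let $V=\{1,\dots,N\}$ and $\mathcal H=\bigotimes_{v\in V}\mathcal H_v$ with $2\le d_v=\dim\mathcal H_v\le D$. On Hermitian operators put $(\mathcal O_1|\mathcal O_2)=\mathrm{tr}(\mathcal O_1\mathcal O_2)/\dim\mathcal H$, and let $\mathbb P_j$ be the orthogonal projection onto the operators that act non-trivially on site $j$, i.e. $\mathbb P_j\mathcal O=\mathcal O-\frac1{d_j}\,1_j\otimes\mathrm{tr}_j\mathcal O$. A Hermitian operator $\mathcal O$ is $X$-local, for $X\subseteq V$, if $\mathbb P_j\mathcal O=\mathcal O$ for $j\in X$ and $\mathbb P_j\mathcal O=0$ for $j\notin X$. For a Hamiltonian $H$ let $\mathcal L\mathcal O=\mathrm i[H,\mathcal O]$, and for nonzero $\{i\}$-local operators $A_i$ $(i\in V)$ let $A_i(t)=\mathrm e^{\mathcal Lt}A_i$, $$C_{ij}(t)=\sqrt{\frac{(A_i(t)|\mathbb P_j|A_i(t))}{(A_i|A_i)}},\qquad t_{\mathrm s}^\delta=\inf\{t>0:\ \text{for all } i,j\in V\text{ there is } s\in[0,t]\text{ with } C_{ij}(s)\ge\delta\}\in[0,\infty].$$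 *Erdős–Rényi ensemble.* For integers $q,m\ge1$ and real $k>0$ with $p:=\frac{(q-1)!\,k}{N^{q-1}m}\le1$, the random factor graph $G$ contains each of the factors $(X,\alpha)$, with $X\subseteq V$, $|X|=q$, $\alpha\in\{1,\dots,m\}$, independently with probability $p$. *Simple random Hamiltonian ensemble.* For every such $G$ let $H=\sum_{X\in G}J_XH_X$, where the $H_X$ are $X$-local Hermitian operators with $(H_X|H_Y)=\mathbb I(X=Y)$ and the $J_X$ are independent real random variables with $\mathbb E[J_X]=0$ and $\mathbb E[J_X^2]\le\frac{\mathcal J^2}{qk}$. The operators $H_X$ and the laws of the $J_X$ may depend on $G$; the $A_i$ are fixed. Let $\mathbb E$ and $\mathbb P$ denote expectation and probability over both $G$ and $J$. **Theorem.** For all $Q,D\in\mathbb N$ and $\mathcal J>0$ there are constants $c_1,c_2,c_3,c_4,\kappa>0$, depending only on $Q,D,\mathcal J$, such that the following hold for all models as above with $q\le Q$. 1. For all $N$, all $i\ne j$ in $V$ and all $t\ge0$, $$\mathbb E\big[C_{ij}(t)^2\big]\le\frac{c_1}{N}\mathrm e^{c_2t}+\frac{c_3}{N^2}\mathrm e^{c_4t^2}.$$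 2. For every $\delta\in(0,1]$, $t_{\mathrm s}^\delta=\Omega(\sqrt{\log N})$ with probability tending to $1$: for every $\varepsilon>0$ there is $N_0$ such that for all $N\ge N_0$ and all such models on $N$ sites $$\mathbb P\big[t_{\mathrm s}^\delta\ge\kappa\sqrt{\log N}\big]\ge1-\varepsilon .$$ -/

import Mathlib

open MeasureTheory

namespace Scrambling

noncomputable section

/-! ### Operators on a finite tensor product Hilbert space -/

/-- Product basis of `⨂ i, ℂ^(d i)`. -/
abbrev Config {N : ℕ} (d : Fin N → ℕ) : Type := (i : Fin N) → Fin (d i)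

/-- Operators on `⨂ i, ℂ^(d i)`, as matrices in the product basis. -/
abbrev Op {N : ℕ} (d : Fin N → ℕ) : Type := Matrix (Config d) (Config d) ℂ

variable {N : ℕ} {d : Fin N → ℕ}

/-- The inner product `(O₁|O₂) = tr (O₁ O₂) / dim` (the trace is real for Hermitian operators). -/
def opInner (O₁ O₂ : Op d) : ℝ :=
  (Matrix.trace (O₁ * O₂)).re / (Fintype.card (Config d) : ℝ)

/-- The part of `O` acting as the identity on site `i`: the normalized partial trace over site `i`,
tensored with the identity on site `i`. -/
def trivialPart (i : Fin N) : Op d →ₗ[ℂ] Op d where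
  toFun O := Matrix.of fun x y =>
    if x i = y i then
      (d i : ℂ)⁻¹ * ∑ c : Fin (d i), O (Function.update x i c) (Function.update y i c)
    else 0
  map_add' O₁ O₂ := by
    ext x y
    by_cases h : x i = y i <;> simp [h, Finset.sum_add_distrib, mul_add]
  map_smul' a O := by
    ext x y
    by_cases h : x i = y i
    · simp only [Matrix.of_apply, h, if_true, Matrix.smul_apply, smul_eq_mul, RingHom.id_apply,
        ← Finset.mul_sum]
      ring
    · simp [h]

/-- The projection `ℙ_i` onto the operators that act non-trivially on site `i`. -/
def proj (i : Fin N) : Op d →ₗ[ℂ] Op d := LinearMap.id - trivialPart i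

/-- The product operator `⨂ v, M v`. -/
def tensorOp (M : (v : Fin N) → Matrix (Fin (d v)) (Fin (d v)) ℂ) : Op d :=
  Matrix.of fun x y => ∏ v, M v (x v) (y v)

theorem trivialPart_tensorOp (i : Fin N)
    (M : (v : Fin N) → Matrix (Fin (d v)) (Fin (d v)) ℂ) :
    trivialPart i (tensorOp M) =
      ((d i : ℂ)⁻¹ * (M i).trace) • tensorOp (Function.update M i 1) := by
  ext x y
  have key : ∀ f : (v : Fin N) → ℂ, ∏ v, f v = f i * ∏ v ∈ Finset.univ.erase i, f v :=
    fun f => (Finset.mul_prod_erase _ f (Finset.mem_univ i)).symm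
  have h2 : ∀ c : Fin (d i),
      ∏ v ∈ Finset.univ.erase i, M v (Function.update x i c v) (Function.update y i c v) =
        ∏ v ∈ Finset.univ.erase i, M v (x v) (y v) := by
    intro c
    refine Finset.prod_congr rfl fun v hv => ?_
    have hv' : v ≠ i := Finset.ne_of_mem_erase hv
    simp [Function.update_of_ne hv']
  have h3 : ∏ v ∈ Finset.univ.erase i, (Function.update M i 1) v (x v) (y v) =
        ∏ v ∈ Finset.univ.erase i, M v (x v) (y v) := by
    refine Finset.prod_congr rfl fun v hv => ?_
    have hv' : v ≠ i := Finset.ne_of_mem_erase hv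
    simp [Function.update_of_ne hv']
  simp only [trivialPart, tensorOp, LinearMap.coe_mk, AddHom.coe_mk, Matrix.of_apply,
    Matrix.smul_apply, smul_eq_mul]
  rw [key (fun v => (Function.update M i 1) v (x v) (y v)), h3]
  simp only [Function.update_self, Matrix.one_apply]
  by_cases h : x i = y i
  · simp only [h, if_true, one_mul, Matrix.trace, Matrix.diag]
    rw [Finset.sum_congr rfl fun c _ =>
      (key fun v => M v (Function.update x i c v) (Function.update y i c v))]
    simp only [h2, Function.update_self, ← Finset.sum_mul]
    ring
  · simp [h]

/-- `ℙ_i` fixes a product operator whose factor at `i` is traceless. -/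
theorem proj_tensorOp_of_trace_eq_zero (i : Fin N)
    (M : (v : Fin N) → Matrix (Fin (d v)) (Fin (d v)) ℂ) (h : (M i).trace = 0) :
    proj i (tensorOp M) = tensorOp M := by
  simp [proj, trivialPart_tensorOp, h]

/-- `ℙ_i` kills a product operator whose factor at `i` is the identity. -/
theorem proj_tensorOp_of_eq_one (i : Fin N) (hd : d i ≠ 0)
    (M : (v : Fin N) → Matrix (Fin (d v)) (Fin (d v)) ℂ) (h : M i = 1) :
    proj i (tensorOp M) = 0 := by
  have hM : Function.update M i 1 = M := by rw [← h]; exact Function.update_eq_self i M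
  have : (d i : ℂ) ≠ 0 := by exact_mod_cast hd
  simp [proj, trivialPart_tensorOp, hM, h, this]

/-- `X`-local operators: Hermitian, with `ℙ_j O = O` for `j ∈ X` and `ℙ_j O = 0` for `j ∉ X`. -/
def IsLocalOn (X : Finset (Fin N)) (O : Op d) : Prop :=
  O.IsHermitian ∧ ∀ j, proj j O = if j ∈ X then O else 0

/-- The Liouvillian `O ↦ i [H, O]`. -/
def liouvillian (H : Op d) : Op d →ₗ[ℂ] Op d :=
  Complex.I • (LinearMap.mulLeft ℂ H - LinearMap.mulRight ℂ H)

/-- Heisenberg evolution `O(t) = e^{ℒ t} O`, through the power series of the exponential. -/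
def evolve (H : Op d) (t : ℝ) (O : Op d) : Op d :=
  ∑' n : ℕ, ((n.factorial : ℂ))⁻¹ • (((t : ℂ) • liouvillian H) ^ n) O

theorem hasSum_exp_commutator {R : Type*} [NormedRing R] [NormedAlgebra ℂ R] [CompleteSpace R]
    (x O : R) :
    HasSum (fun n : ℕ => ((n.factorial : ℂ))⁻¹ •
        ((LinearMap.mulLeft ℂ x - LinearMap.mulRight ℂ x) ^ n) O)
      (NormedSpace.exp x * O * NormedSpace.exp (-x)) := by
  letI : NormedAlgebra ℚ R := NormedAlgebra.restrictScalars ℚ ℂ R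
  letI : NormedAlgebra ℚ (R →L[ℂ] R) := NormedAlgebra.restrictScalars ℚ ℂ _
  let a : R →L[ℂ] R := ContinuousLinearMap.mul ℂ R x
  let b : R →L[ℂ] R := (ContinuousLinearMap.mul ℂ R).flip (-x)
  have series : ∀ (f : R →L[ℂ] R) (y : R),
      HasSum (fun n : ℕ => ((n.factorial : ℂ))⁻¹ • (f ^ n) y) (NormedSpace.exp f y) := by
    intro f y
    have h := NormedSpace.exp_series_hasSum_exp' (𝕂 := ℂ) f
    simpa using (ContinuousLinearMap.apply ℂ R y).hasSum h
  have hcomm : Commute a b := by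
    ext y
    simp [a, b, mul_assoc]
  have ha : ∀ y, NormedSpace.exp a y = NormedSpace.exp x * y := by
    intro y
    have hp : ∀ n : ℕ, (a ^ n) y = x ^ n * y := by
      intro n
      induction n with
      | zero => simp
      | succ n ih => rw [pow_succ', pow_succ', mul_assoc, ← ih]; rfl
    refine (series a y).unique ?_
    have h := (NormedSpace.exp_series_hasSum_exp' (𝕂 := ℂ) x).mul_right y
    simpa [hp, smul_mul_assoc] using h
  have hb : ∀ y, NormedSpace.exp b y = y * NormedSpace.exp (-x) := by
    intro y
    have hp : ∀ n : ℕ, (b ^ n) y = y * (-x) ^ n := by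
      intro n
      induction n with
      | zero => simp
      | succ n ih => rw [pow_succ', pow_succ, ← mul_assoc, ← ih]; rfl
    refine (series b y).unique ?_
    have h := (NormedSpace.exp_series_hasSum_exp' (𝕂 := ℂ) (-x)).mul_left y
    simpa only [hp, mul_smul_comm] using h
  have h := series (a + b) O
  have hexp : NormedSpace.exp (a + b) O = NormedSpace.exp x * O * NormedSpace.exp (-x) := by
    rw [NormedSpace.exp_add_of_commute hcomm, ContinuousLinearMap.mul_apply, ha, hb, mul_assoc]
  rw [hexp] at h
  have hpow : ∀ n : ℕ, ((LinearMap.mulLeft ℂ x - LinearMap.mulRight ℂ x) ^ n) O =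
      ((a + b) ^ n) O := by
    intro n
    induction n with
    | zero => simp
    | succ n ih =>
      rw [pow_succ', pow_succ', Module.End.mul_apply, ContinuousLinearMap.mul_apply, ih]
      simp [a, b, sub_eq_add_neg]
  simpa only [hpow] using h

/-- The power series that defines `evolve` converges, and its sum is `e^{iHt} O e^{-iHt}`. -/
theorem hasSum_evolve (H : Op d) (t : ℝ) (O : Op d) :
    HasSum (fun n : ℕ => ((n.factorial : ℂ))⁻¹ • (((t : ℂ) • liouvillian H) ^ n) O)
      (NormedSpace.exp ((t * Complex.I) • H) * O * NormedSpace.exp (-((t * Complex.I) • H))) := by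
  letI : NormedRing (Op d) := Matrix.linftyOpNormedRing
  letI : NormedAlgebra ℂ (Op d) := Matrix.linftyOpNormedAlgebra
  have h := hasSum_exp_commutator ((t * Complex.I) • H) O
  have hL : (t : ℂ) • liouvillian H = LinearMap.mulLeft ℂ ((t * Complex.I) • H) -
      LinearMap.mulRight ℂ ((t * Complex.I) • H) := by
    apply LinearMap.ext
    intro y
    simp [liouvillian, smul_smul, smul_sub]
  rw [hL]
  exact h

theorem evolve_eq (H : Op d) (t : ℝ) (O : Op d) :
    evolve H t O =
      NormedSpace.exp ((t * Complex.I) • H) * O * NormedSpace.exp (-((t * Complex.I) • H)) :=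
  (hasSum_evolve H t O).tsum_eq

/-- `C_{ij}(t)` for the initial operator `A` (on site `i`) and the target site `j`. -/
def opSpread (H A : Op d) (j : Fin N) (t : ℝ) : ℝ :=
  Real.sqrt (opInner (evolve H t A) (proj j (evolve H t A)) / opInner A A)

/-- The operator scrambling time: the infimum of the times `t > 0` by which `C_{ij}` has reached the
value `δ` for all pairs of sites `i, j`; it is `∞` if there is no such time. -/
def scramblingTime (H : Op d) (A : Fin N → Op d) (δ : ℝ) : ENNReal :=
  sInf {τ | ∃ t : ℝ, 0 < t ∧ τ = ENNReal.ofReal t ∧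
    ∀ i j : Fin N, ∃ s ∈ Set.Icc 0 t, δ ≤ opSpread H (A i) j s}

/-! ### Erdős–Rényi factor graphs -/

/-- The factors of the complete `q`-local factor graph on `N` nodes with `m` flavors. -/
abbrev Factor (N q m : ℕ) : Type := {X : Finset (Fin N) // X.card = q} × Fin m

/-- `q`-local factor graphs on `N` nodes, with at most `m` factors on each set of `q` nodes,
given by their factor sets. -/
abbrev FactorGraph (N q m : ℕ) : Type := Finset (Factor N q m)

/-- The probability with which each factor is present. -/
def factorProb (N q m : ℕ) (k : ℝ) : ℝ :=
  ((q - 1).factorial : ℝ) * k / ((N : ℝ) ^ (q - 1) * (m : ℝ))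

/-- The probability of the factor graph `G` when the factors are chosen independently. -/
def graphProb {N q m : ℕ} (k : ℝ) (G : FactorGraph N q m) : ℝ :=
  ∏ X : Factor N q m, if X ∈ G then factorProb N q m k else 1 - factorProb N q m k

/-- Expectation over the Erdős–Rényi ensemble of factor graphs. -/
def graphExpect {N q m : ℕ} (k : ℝ) (f : FactorGraph N q m → ℝ) : ℝ :=
  ∑ G : FactorGraph N q m, graphProb k G * f G

/-- The weights of the Erdős–Rényi ensemble sum to one. -/
theorem graphExpect_one {N q m : ℕ} (k : ℝ) :
    graphExpect k (fun _ : FactorGraph N q m => (1 : ℝ)) = 1 := by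
  have h := Finset.prod_add (fun _ : Factor N q m => factorProb N q m k)
    (fun _ => 1 - factorProb N q m k) Finset.univ
  simp only [add_sub_cancel, Finset.prod_const_one, Finset.powerset_univ] at h
  refine Eq.trans ?_ h.symm
  unfold graphExpect
  refine Finset.sum_congr rfl fun G _ => ?_
  rw [mul_one]
  unfold graphProb
  rw [Finset.prod_ite]
  congr 1
  · exact Finset.prod_congr (by ext; simp) fun _ _ => rfl
  · exact Finset.prod_congr (by ext; simp) fun _ _ => rfl

/-! ### Random Hamiltonians -/

/-- A simple random Hamiltonian ensemble on the factor graph `G`: orthonormal operators `H_X`, each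
local on its factor, with independent couplings `J_X` of mean zero, `J_X` having the law `law X`. -/
structure SimpleEnsemble {N q m : ℕ} (d : Fin N → ℕ) (G : FactorGraph N q m) where
  term : {X // X ∈ G} → Op d
  isLocal : ∀ X, IsLocalOn X.1.1.1 (term X)
  orthonormal : ∀ X Y, opInner (term X) (term Y) = if X = Y then 1 else 0
  law : {X // X ∈ G} → Measure ℝ
  isProb : ∀ X, IsProbabilityMeasure (law X)
  integrable : ∀ X, Integrable (fun x : ℝ => x) (law X)
  mean_zero : ∀ X, ∫ x, x ∂(law X) = 0

namespace SimpleEnsemble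

variable {q m : ℕ} {G : FactorGraph N q m}

/-- The joint law of the couplings. -/
def couplingLaw (E : SimpleEnsemble d G) : Measure ({X // X ∈ G} → ℝ) := Measure.pi E.law

/-- The Hamiltonian `H(J) = ∑ J_X H_X`. -/
def hamiltonian (E : SimpleEnsemble d G) (J : {X // X ∈ G} → ℝ) : Op d :=
  ∑ X, (J X : ℂ) • E.term X

/-- Every coupling has a finite variance that is at most `v`. -/
def VarianceLE (E : SimpleEnsemble d G) (v : ℝ) : Prop :=
  ∀ X, Integrable (fun x : ℝ => x ^ 2) (E.law X) ∧ ∫ x, x ^ 2 ∂(E.law X) ≤ v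

end SimpleEnsemble

end

end Scrambling

/-!
The weight of `A(t)` on a site `j` is controlled by a recursion that removes the sites one by one.
For a set `R` of sites let `A^R(t)` be the evolution of `A` without the factors that meet `R`. If
`A` does not act on `j`, then neither does `A^{R ∪ {j}}(s)`, and Duhamel's formula gives
`ℙ_j A^R(t) = ℙ_j ∫₀ᵗ e^{ℒ^R (t - s)} ∑_{X ∋ j} J_X ℒ_X A^{R ∪ {j}}(s) ds`, where the sum runs over
the factors that contain `j` and avoid `R`. Two facts make this identity effective.

* The outer evolution is unitary, so its norm is removed before any average is taken. With the
  weight `e^{t - s}` in the Cauchy–Schwarz inequality this costs only a factor `e^t`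
  (`norm_vec_proj_evolve_sq_le`). The resulting bound, `SimpleEnsemble.cumulativeInflux`, is
  increasing in `t` and therefore holds for all earlier times at once.
* The operator `A^{R ∪ {j}}(s)` is independent of the couplings `J_X` with `X ∋ j`, which have mean
  zero. All cross terms of the mean square vanish, and each diagonal term contributes the variance
  of `J_X` times the weight of `A^{R ∪ {j}}(s)` on the other sites of `X`
  (`SimpleEnsemble.integral_norm_influx_sq_le`). A commutator with a normalized local operator is
  bounded independently of the system size (`norm_vec_liouvillian_le`).

Iterating until the site of the initial operator is reached bounds the mean weight by a sum over
self-avoiding paths of factors (`SimpleEnsemble.integral_norm_vec_proj_evolved_sq_le`). No factor is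
used twice, so the average over the Erdős–Rényi graph gives one power of the edge probability per
factor. This cancels the power of `k` in the variance of the coupling, and the requirement that the
path ends at a given site costs a factor `1 / N` (`graphExpect_pathBound_le`). Altogether the mean
of `C_{ij}(t) ^ 2` is at most `e^{c t} / N`, which is stronger than the first claim. The second
claim follows from Markov's inequality for the cumulative influx between one pair of sites.
-/

namespace Scrambling

variable {N : ℕ} {d : Fin N → ℕ}

/-! ### Operators that are trivial on a site -/

theorem trivialPart_apply (j : Fin N) (O : Op d) (x y : Config d) :
    trivialPart j O x y = if x j = y j then
      (d j : ℂ)⁻¹ * ∑ c : Fin (d j), O (Function.update x j c) (Function.update y j c) else 0 :=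
  rfl

theorem trivialPart_apply_of_eq {j : Fin N} {x y : Config d} (h : x j = y j) (O : Op d) :
    trivialPart j O x y =
      (d j : ℂ)⁻¹ * ∑ c : Fin (d j), O (Function.update x j c) (Function.update y j c) := by
  rw [trivialPart_apply, if_pos h]

theorem trivialPart_apply_of_ne {j : Fin N} {x y : Config d} (h : x j ≠ y j) (O : Op d) :
    trivialPart j O x y = 0 := by
  rw [trivialPart_apply, if_neg h]

theorem trivialPart_update (j : Fin N) (O : Op d) {x y : Config d} (h : x j = y j)
    (c : Fin (d j)) :
    trivialPart j O (Function.update x j c) (Function.update y j c) = trivialPart j O x y := by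
  rw [trivialPart_apply_of_eq h, trivialPart_apply_of_eq (by simp)]
  simp

theorem trivialPart_trivialPart (j : Fin N) (O : Op d) :
    trivialPart j (trivialPart j O) = trivialPart j O := by
  ext x y
  by_cases h : x j = y j
  · have hd : (d j : ℂ) ≠ 0 := by
      have := (x j).pos
      exact_mod_cast this.ne'
    rw [trivialPart_apply_of_eq h]
    simp [trivialPart_update j O h, hd]
  · rw [trivialPart_apply_of_ne h, trivialPart_apply_of_ne h]

theorem trivialPart_conjTranspose (j : Fin N) (O : Op d) :
    trivialPart j O.conjTranspose = (trivialPart j O).conjTranspose := by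
  ext x y
  rw [Matrix.conjTranspose_apply]
  by_cases h : x j = y j
  · rw [trivialPart_apply_of_eq h, trivialPart_apply_of_eq h.symm]
    simp
  · rw [trivialPart_apply_of_ne h, trivialPart_apply_of_ne (Ne.symm h), star_zero]

theorem trivialPart_comm {i j : Fin N} (hij : i ≠ j) (O : Op d) :
    trivialPart i (trivialPart j O) = trivialPart j (trivialPart i O) := by
  ext x y
  by_cases hi : x i = y i <;> by_cases hj : x j = y j
  · rw [trivialPart_apply_of_eq hi, trivialPart_apply_of_eq hj]
    have h1 : ∀ c, trivialPart j O (Function.update x i c) (Function.update y i c) =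
        (d j : ℂ)⁻¹ * ∑ b : Fin (d j), O (Function.update (Function.update x i c) j b)
          (Function.update (Function.update y i c) j b) := fun c =>
      trivialPart_apply_of_eq (by simp [Function.update_of_ne hij.symm, hj]) O
    have h2 : ∀ b, trivialPart i O (Function.update x j b) (Function.update y j b) =
        (d i : ℂ)⁻¹ * ∑ c : Fin (d i), O (Function.update (Function.update x j b) i c)
          (Function.update (Function.update y j b) i c) := fun b =>
      trivialPart_apply_of_eq (by simp [Function.update_of_ne hij, hi]) O
    simp only [h1, h2, ← Finset.mul_sum]
    rw [Finset.sum_comm]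
    simp only [Function.update_comm hij]
    ring
  · rw [trivialPart_apply_of_eq hi, trivialPart_apply_of_ne hj]
    simp [trivialPart_apply, Function.update_of_ne hij.symm, hj]
  · rw [trivialPart_apply_of_ne hi, trivialPart_apply_of_eq hj]
    simp [trivialPart_apply, Function.update_of_ne hij, hi]
  · rw [trivialPart_apply_of_ne hi, trivialPart_apply_of_ne hj]

theorem trace_trivialPart (j : Fin N) (O : Op d) :
    (trivialPart j O).trace = O.trace := by
  have hsum : ∑ z : Config d × Fin (d j),
      O (Function.update z.1 j z.2) (Function.update z.1 j z.2) =
      ∑ z : Config d × Fin (d j), O z.1 z.1 := by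
    refine Fintype.sum_bijective (fun z => (Function.update z.1 j z.2, z.1 j))
      (Function.Involutive.bijective fun z => ?_) _ _ fun z => rfl
    ext <;> simp
  rw [Fintype.sum_prod_type, Fintype.sum_prod_type] at hsum
  simp only [Matrix.trace, Matrix.diag, trivialPart_apply, if_true, ← Finset.mul_sum]
  rw [hsum]
  simp only [Finset.sum_const, Finset.card_univ, Fintype.card_fin, nsmul_eq_mul, ← Finset.mul_sum]
  rcases Nat.eq_zero_or_pos (d j) with h0 | hpos
  · have : IsEmpty (Config d) := ⟨fun x => by have := (x j).pos; omega⟩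
    simp
  · have hd : (d j : ℂ) ≠ 0 := by exact_mod_cast hpos.ne'
    rw [inv_mul_cancel_left₀ hd]

theorem apply_update_of_trivial {j : Fin N} {O : Op d} (hO : trivialPart j O = O)
    {x y : Config d} (h : x j = y j) (c : Fin (d j)) :
    O (Function.update x j c) (Function.update y j c) = O x y := by
  rw [← hO]; exact trivialPart_update j O h c

theorem apply_eq_zero_of_trivial {j : Fin N} {O : Op d} (hO : trivialPart j O = O)
    {x y : Config d} (h : x j ≠ y j) : O x y = 0 := by
  rw [← hO]; exact trivialPart_apply_of_ne h O

/-- The permutation of the product basis that permutes the basis of one site. -/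
def sitePerm (j : Fin N) (σ : Equiv.Perm (Fin (d j))) : Equiv.Perm (Config d) where
  toFun z := Function.update z j (σ (z j))
  invFun z := Function.update z j (σ.symm (z j))
  left_inv z := by simp
  right_inv z := by simp

theorem sitePerm_apply (j : Fin N) (σ : Equiv.Perm (Fin (d j))) (z : Config d) :
    sitePerm j σ z = Function.update z j (σ (z j)) := rfl

theorem apply_sitePerm_of_trivial {j : Fin N} {O : Op d} (hO : trivialPart j O = O)
    (σ : Equiv.Perm (Fin (d j))) (x y : Config d) :
    O (sitePerm j σ x) (sitePerm j σ y) = O x y := by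
  by_cases h : x j = y j
  · rw [sitePerm_apply, sitePerm_apply, ← h, apply_update_of_trivial hO h]
  · rw [apply_eq_zero_of_trivial hO h, apply_eq_zero_of_trivial hO]
    simpa [sitePerm_apply] using h

/-- The partial trace over a site is linear over the operators that are trivial on that site. -/
theorem trivialPart_mul {j : Fin N} {H : Op d} (hH : trivialPart j H = H) (O : Op d) :
    trivialPart j (H * O) = H * trivialPart j O := by
  ext x y
  by_cases h : x j = y j
  · rw [trivialPart_apply_of_eq h, Matrix.mul_apply]
    have key : ∀ c, (H * O) (Function.update x j c) (Function.update y j c) =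
        ∑ z, if z j = x j then
          H x z * O (Function.update z j c) (Function.update y j c) else 0 := by
      intro c
      rw [Matrix.mul_apply, ← Equiv.sum_comp (sitePerm j (Equiv.swap (x j) c))]
      refine Finset.sum_congr rfl fun z _ => ?_
      have hx : Function.update x j c = sitePerm j (Equiv.swap (x j) c) x := by
        simp [sitePerm_apply]
      rw [hx, apply_sitePerm_of_trivial hH]
      split_ifs with hz
      · rw [sitePerm_apply, hz, Equiv.swap_apply_left]
      · rw [apply_eq_zero_of_trivial hH (Ne.symm hz), zero_mul]
    simp only [key]
    rw [Finset.sum_comm, Finset.mul_sum]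
    refine Finset.sum_congr rfl fun z _ => ?_
    split_ifs with hz
    · rw [trivialPart_apply_of_eq (hz.trans h), ← Finset.mul_sum]
      ring
    · rw [apply_eq_zero_of_trivial hH (Ne.symm hz)]
      simp
  · rw [trivialPart_apply_of_ne h, Matrix.mul_apply]
    refine (Finset.sum_eq_zero fun z _ => ?_).symm
    by_cases hz : x j = z j
    · rw [trivialPart_apply_of_ne (fun hzy => h (hz.trans hzy)), mul_zero]
    · rw [apply_eq_zero_of_trivial hH hz, zero_mul]

theorem trivialPart_mul_right {j : Fin N} {H : Op d} (hH : trivialPart j H = H) (O : Op d) :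
    trivialPart j (O * H) = trivialPart j O * H := by
  have hH' : trivialPart j H.conjTranspose = H.conjTranspose := by
    rw [trivialPart_conjTranspose, hH]
  have h := trivialPart_mul hH' O.conjTranspose
  rw [← Matrix.conjTranspose_mul, trivialPart_conjTranspose, trivialPart_conjTranspose,
    ← Matrix.conjTranspose_mul] at h
  exact Matrix.conjTranspose_injective h

/-- Evolution under terms that are trivial on a site commutes with the projection on that site. -/
theorem proj_liouvillian {j : Fin N} {H : Op d} (hH : trivialPart j H = H) (O : Op d) :
    proj j (liouvillian H O) = liouvillian H (proj j O) := by
  simp only [proj, liouvillian, LinearMap.sub_apply, LinearMap.smul_apply, LinearMap.mulLeft_apply,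
    LinearMap.mulRight_apply, LinearMap.id_apply, map_smul, map_sub, trivialPart_mul hH,
    trivialPart_mul_right hH]
  module

/-- An operator does not act on the site `j` exactly when it is its own normalized partial trace. -/
theorem proj_eq_zero_iff (j : Fin N) (O : Op d) : proj j O = 0 ↔ trivialPart j O = O := by
  simp only [proj, LinearMap.sub_apply, LinearMap.id_apply, sub_eq_zero]
  exact eq_comm

theorem IsLocalOn.trivialPart_eq {X : Finset (Fin N)} {O : Op d} (hO : IsLocalOn X O) {j : Fin N}
    (hj : j ∉ X) : trivialPart j O = O := by
  rw [← proj_eq_zero_iff, hO.2 j, if_neg hj]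

/-! ### The Hilbert–Schmidt norm -/

/-- Operators as vectors of a Hilbert space, for the unnormalized Hilbert–Schmidt inner product
`⟪A, B⟫ = tr (A† B)`. -/
noncomputable def vec : Op d ≃ₗ[ℂ] EuclideanSpace ℂ (Config d × Config d) :=
  (LinearEquiv.curry ℂ ℂ (Config d) (Config d)).symm.trans
    (WithLp.linearEquiv 2 ℂ (Config d × Config d → ℂ)).symm

theorem vec_apply (O : Op d) (z : Config d × Config d) : vec O z = O z.1 z.2 := rfl

theorem inner_vec (A B : Op d) : inner ℂ (vec A) (vec B) = (A.conjTranspose * B).trace := by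
  rw [PiLp.inner_apply, Fintype.sum_prod_type, Finset.sum_comm]
  simp only [Matrix.trace, Matrix.diag, Matrix.mul_apply, Matrix.conjTranspose_apply, vec_apply,
    RCLike.inner_apply]
  exact Finset.sum_congr rfl fun x _ => Finset.sum_congr rfl fun y _ => mul_comm _ _

theorem norm_vec_sq (O : Op d) : ‖vec O‖ ^ 2 = ∑ x, ∑ y, ‖O x y‖ ^ 2 := by
  rw [EuclideanSpace.norm_sq_eq, Fintype.sum_prod_type]
  rfl

theorem norm_vec_sq_eq_re_trace (O : Op d) : ‖vec O‖ ^ 2 = (O.conjTranspose * O).trace.re := by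
  rw [← inner_vec, ← inner_self_eq_norm_sq (𝕜 := ℂ)]
  rfl

theorem norm_vec_conjTranspose (O : Op d) : ‖vec O.conjTranspose‖ = ‖vec O‖ := by
  rw [← sq_eq_sq₀ (norm_nonneg _) (norm_nonneg _), norm_vec_sq, norm_vec_sq, Finset.sum_comm]
  simp

theorem opInner_self {O : Op d} (hO : O.IsHermitian) :
    opInner O O = ‖vec O‖ ^ 2 / Fintype.card (Config d) := by
  rw [norm_vec_sq_eq_re_trace, hO.eq, opInner]

theorem inner_vec_trivialPart (j : Fin N) (O : Op d) :
    inner ℂ (vec (trivialPart j O)) (vec O) =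
      inner ℂ (vec (trivialPart j O)) (vec (trivialPart j O)) := by
  have h : trivialPart j (trivialPart j O).conjTranspose = (trivialPart j O).conjTranspose := by
    rw [trivialPart_conjTranspose, trivialPart_trivialPart]
  rw [inner_vec, inner_vec, ← trivialPart_mul h, trace_trivialPart]

theorem inner_vec_trivialPart_proj (j : Fin N) (O : Op d) :
    inner ℂ (vec (trivialPart j O)) (vec (proj j O)) = 0 := by
  rw [proj, LinearMap.sub_apply, LinearMap.id_apply, map_sub, inner_sub_right,
    inner_vec_trivialPart, sub_self]

theorem norm_vec_sq_eq_add (j : Fin N) (O : Op d) :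
    ‖vec O‖ ^ 2 = ‖vec (trivialPart j O)‖ ^ 2 + ‖vec (proj j O)‖ ^ 2 := by
  have h := norm_add_sq_eq_norm_sq_add_norm_sq_of_inner_eq_zero
    (vec (trivialPart j O)) (vec (proj j O)) (inner_vec_trivialPart_proj j O)
  have hO : vec O = vec (trivialPart j O) + vec (proj j O) := by
    rw [← map_add]; simp [proj]
  rw [hO]
  nlinarith [h]

theorem norm_vec_trivialPart_le (j : Fin N) (O : Op d) : ‖vec (trivialPart j O)‖ ≤ ‖vec O‖ := by
  rw [← sq_le_sq₀ (norm_nonneg _) (norm_nonneg _), norm_vec_sq_eq_add j O]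
  nlinarith [sq_nonneg ‖vec (proj j O)‖]

theorem norm_vec_proj_le (j : Fin N) (O : Op d) : ‖vec (proj j O)‖ ≤ ‖vec O‖ := by
  rw [← sq_le_sq₀ (norm_nonneg _) (norm_nonneg _), norm_vec_sq_eq_add j O]
  nlinarith [sq_nonneg ‖vec (trivialPart j O)‖]

/-- The projection `ℙ_j` is orthogonal, so that its matrix element in a Hermitian operator is a
square norm. -/
theorem opInner_proj (j : Fin N) {O : Op d} (hO : O.IsHermitian) :
    opInner O (proj j O) = ‖vec (proj j O)‖ ^ 2 / Fintype.card (Config d) := by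
  have h : (O.conjTranspose * proj j O).trace =
      inner ℂ (vec (proj j O)) (vec (proj j O)) := by
    have hO' : vec O = vec (trivialPart j O) + vec (proj j O) := by
      rw [← map_add]; simp [proj]
    rw [← inner_vec, hO', inner_add_left, inner_vec_trivialPart_proj, zero_add]
  rw [opInner, ← inner_self_eq_norm_sq (𝕜 := ℂ), ← h, hO.eq]
  rfl

/-- The Hilbert–Schmidt norm is unitarily invariant. -/
theorem norm_vec_conj {U V : Op d} (hU : U.conjTranspose * U = 1) (hV : V * V.conjTranspose = 1)
    (O : Op d) : ‖vec (U * O * V)‖ = ‖vec O‖ := by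
  rw [← sq_eq_sq₀ (norm_nonneg _) (norm_nonneg _), norm_vec_sq_eq_re_trace,
    norm_vec_sq_eq_re_trace]
  congr 1
  rw [Matrix.conjTranspose_mul, Matrix.conjTranspose_mul]
  calc (V.conjTranspose * (O.conjTranspose * U.conjTranspose) * (U * O * V)).trace
      = (V.conjTranspose * (O.conjTranspose * (U.conjTranspose * U) * O * V)).trace := by
        simp only [Matrix.mul_assoc]
    _ = ((O.conjTranspose * O) * (V * V.conjTranspose)).trace := by
        rw [Matrix.trace_mul_comm, hU]
        simp only [Matrix.mul_assoc, Matrix.mul_one]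
    _ = _ := by rw [hV, Matrix.mul_one]

/-! ### Commutators with local operators -/

/-- A function of two configurations that is invariant under simultaneous changes at each site
outside `X` is invariant under simultaneous changes outside `X`. -/
theorem eq_of_forall_update {α : Type*} {X : Finset (Fin N)} {f : Config d → Config d → α}
    (hf : ∀ j ∉ X, ∀ x y c, x j = y j →
      f (Function.update x j c) (Function.update y j c) = f x y)
    (x y w : Config d) (hxy : ∀ j ∉ X, x j = y j) :
    f (X.piecewise x w) (X.piecewise y w) = f x y := by
  have key : ∀ S : Finset (Fin N), Disjoint S X →
      f (S.piecewise w x) (S.piecewise w y) = f x y := by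
    intro S
    induction S using Finset.induction_on with
    | empty => intro _; simp
    | insert j S hj ih =>
      intro hS
      have hjX : j ∉ X := Finset.disjoint_left.1 hS (Finset.mem_insert_self _ _)
      rw [Finset.piecewise_insert, Finset.piecewise_insert, hf j hjX, ih]
      · exact Finset.disjoint_of_subset_left (Finset.subset_insert _ _) hS
      · simp [hj, hxy j hjX]
  have h := key Xᶜ disjoint_compl_left
  rwa [Finset.piecewise_compl, Finset.piecewise_compl] at h

theorem apply_eq_zero_of_forall_trivial {X : Finset (Fin N)} {H : Op d}
    (hH : ∀ j ∉ X, trivialPart j H = H) {x y : Config d} (h : ¬ ∀ j ∉ X, x j = y j) :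
    H x y = 0 := by
  push Not at h
  obtain ⟨j, hj, hne⟩ := h
  exact apply_eq_zero_of_trivial (hH j hj) hne

/-- The entries of an operator that is trivial outside `X` only depend on the sites in `X`. -/
theorem apply_piecewise_of_forall_trivial {X : Finset (Fin N)} {H : Op d}
    (hH : ∀ j ∉ X, trivialPart j H = H) (x y w : Config d) (hxy : ∀ j ∉ X, x j = y j) :
    H (X.piecewise x w) (X.piecewise y w) = H x y :=
  eq_of_forall_update (f := fun x y => H x y)
    (fun j hj _ _ c h => apply_update_of_trivial (hH j hj) h c) x y w hxy

/-- Operators with disjoint supports commute. -/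
theorem commute_of_forall_trivial {X : Finset (Fin N)} {H O : Op d}
    (hH : ∀ j ∉ X, trivialPart j H = H) (hO : ∀ j ∈ X, trivialPart j O = O) : H * O = O * H := by
  have hO' : ∀ j ∉ Xᶜ, trivialPart j O = O := fun j hj => hO j (by simpa using hj)
  ext x y
  -- `H` keeps the configuration outside `X` and `O` keeps it on `X`, so that each product has a
  -- single intermediate configuration.
  rw [Matrix.mul_apply, Matrix.mul_apply,
    Finset.sum_eq_single (X.piecewise y x), Finset.sum_eq_single (X.piecewise x y)]
  · have h1 := apply_piecewise_of_forall_trivial hH x (X.piecewise y x) y (fun j hj => by simp [hj])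
    have h2 := apply_piecewise_of_forall_trivial hO' x (X.piecewise x y) y
      (fun j hj => by simp [show j ∈ X by simpa using hj])
    rw [← h1, ← h2, mul_comm]
    congr 2
    · ext j; by_cases hj : j ∈ X <;> simp [hj]
    · ext j; by_cases hj : j ∈ X <;> simp [hj]
    · ext j; by_cases hj : j ∈ X <;> simp [hj]
  · intro z _ hz
    by_cases h1 : ∀ j ∉ Xᶜ, x j = z j
    · by_cases h2 : ∀ j ∉ X, z j = y j
      · refine absurd (funext fun j => ?_) hz
        by_cases hj : j ∈ X
        · simp [hj, h1 j (by simpa using hj)]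
        · simp [hj, h2 j hj]
      · rw [apply_eq_zero_of_forall_trivial hH h2, mul_zero]
    · rw [apply_eq_zero_of_forall_trivial hO' h1, zero_mul]
  · simp
  · intro z _ hz
    by_cases h1 : ∀ j ∉ X, x j = z j
    · by_cases h2 : ∀ j ∉ Xᶜ, z j = y j
      · refine absurd (funext fun j => ?_) hz
        by_cases hj : j ∈ X
        · simp [hj, h2 j (by simpa using hj)]
        · simp [hj, h1 j hj]
      · rw [apply_eq_zero_of_forall_trivial hO' h2, mul_zero]
    · rw [apply_eq_zero_of_forall_trivial hH h1, zero_mul]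
  · simp

/-- The number of configurations with prescribed values on the sites outside `X`. -/
theorem card_agree_compl_le {X : Finset (Fin N)} {D : ℕ} (hD : ∀ v, d v ≤ D) (z : Config d) :
    (Finset.univ.filter fun x : Config d => ∀ j ∉ X, x j = z j).card ≤ D ^ X.card := by
  have h : (Finset.univ.filter fun x : Config d => ∀ j ∉ X, x j = z j) =
      Fintype.piFinset fun j => if j ∈ X then Finset.univ else {z j} := by
    ext x
    simp only [Finset.mem_filter, Finset.mem_univ, true_and, Fintype.mem_piFinset]
    refine forall_congr' fun j => ?_
    by_cases hj : j ∈ X <;> simp [hj]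
  rw [h, Fintype.card_piFinset, ← Finset.prod_const, ← Finset.prod_subset (Finset.subset_univ X)]
  · refine Finset.prod_le_prod' fun j hj => ?_
    simpa [hj] using hD j
  · intro j _ hj
    simp [hj]

theorem card_config_le {X : Finset (Fin N)} {D : ℕ} (hD : ∀ v, d v ≤ D) (z : Config d) :
    Fintype.card (Config d) ≤
      D ^ X.card * (Finset.univ.filter fun x : Config d => ∀ j ∈ X, x j = z j).card := by
  have h : (Finset.univ.filter fun x : Config d => ∀ j ∈ X, x j = z j) =
      Fintype.piFinset fun j => if j ∈ X then {z j} else Finset.univ := by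
    ext x
    simp only [Finset.mem_filter, Finset.mem_univ, true_and, Fintype.mem_piFinset]
    refine forall_congr' fun j => ?_
    by_cases hj : j ∈ X <;> simp [hj]
  have h1 : ∏ j ∈ X, (if j ∈ X then {z j} else (Finset.univ : Finset (Fin (d j)))).card = 1 :=
    Finset.prod_eq_one fun j hj => by simp [hj]
  rw [h, Fintype.card_piFinset, ← Finset.prod_mul_prod_compl X, h1, one_mul, Fintype.card_pi,
    ← Finset.prod_mul_prod_compl X, ← Finset.prod_const]
  refine Nat.mul_le_mul (Finset.prod_le_prod' fun j _ => by simpa using hD j)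
    (Finset.prod_le_prod' fun j hj => ?_)
  have hj' : j ∉ X := by simpa using hj
  simp [hj']

/-- Each row of a normalized Hermitian operator with support in `X` has a bounded square sum,
because the square sum of a row only depends on the sites in `X`. -/
theorem sum_row_sq_le {X : Finset (Fin N)} {D : ℕ} (hD : ∀ v, d v ≤ D) {H : Op d}
    (hH : ∀ j ∉ X, trivialPart j H = H) (hnorm : ‖vec H‖ ^ 2 = Fintype.card (Config d))
    (x : Config d) : ∑ z, ‖H x z‖ ^ 2 ≤ (D : ℝ) ^ X.card := by
  set r : Config d → ℝ := fun x => ∑ z, ‖H x z‖ ^ 2 with hr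
  have hr0 : ∀ x, 0 ≤ r x := fun x => Finset.sum_nonneg fun _ _ => sq_nonneg _
  have hinv : ∀ j ∉ X, ∀ x c, r (Function.update x j c) = r x := by
    intro j hj x c
    have hx : Function.update x j c = sitePerm j (Equiv.swap (x j) c) x := by
      simp [sitePerm_apply]
    rw [hx, hr]
    simp only
    rw [← Equiv.sum_comp (sitePerm j (Equiv.swap (x j) c))]
    simp only [apply_sitePerm_of_trivial (hH j hj)]
  have hconst : ∀ y : Config d, (∀ j ∈ X, y j = x j) → r y = r x := by
    intro y hy
    have h := eq_of_forall_update (X := X) (f := fun x _ => r x)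
      (fun j hj x _ c _ => hinv j hj x c) x x y fun _ _ => rfl
    rw [← h]
    congr 1
    ext j
    by_cases hj : j ∈ X <;> simp [hj, hy]
  set S := Finset.univ.filter fun y : Config d => ∀ j ∈ X, y j = x j with hS
  have hSpos : 0 < S.card := Finset.card_pos.2 ⟨x, by simp [hS]⟩
  have hsum : (S.card : ℝ) * r x ≤ Fintype.card (Config d) := by
    rw [← hnorm, norm_vec_sq, ← nsmul_eq_mul, ← Finset.sum_const]
    calc ∑ _y ∈ S, r x = ∑ y ∈ S, r y :=
          Finset.sum_congr rfl fun y hy => (hconst y (by simpa [hS] using hy)).symm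
      _ ≤ ∑ y, r y := Finset.sum_le_sum_of_subset_of_nonneg (Finset.subset_univ _)
          fun y _ _ => hr0 y
  have hcard : (Fintype.card (Config d) : ℝ) ≤ (D : ℝ) ^ X.card * S.card := by
    exact_mod_cast card_config_le (X := X) hD x
  have hSpos' : (0 : ℝ) < S.card := by exact_mod_cast hSpos
  exact le_of_mul_le_mul_left (by linarith [mul_comm ((D : ℝ) ^ X.card) (S.card : ℝ)]) hSpos'

/-- Multiplication by a normalized local operator is bounded independently of the system size. -/
theorem norm_vec_mul_le {X : Finset (Fin N)} {D : ℕ} (hD : ∀ v, d v ≤ D) {H : Op d}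
    (hH : ∀ j ∉ X, trivialPart j H = H) (hnorm : ‖vec H‖ ^ 2 = Fintype.card (Config d))
    (O : Op d) : ‖vec (H * O)‖ ≤ (D : ℝ) ^ X.card * ‖vec O‖ := by
  rw [← sq_le_sq₀ (norm_nonneg _) (by positivity), mul_pow, norm_vec_sq, norm_vec_sq]
  have hentry : ∀ x y, ‖(H * O) x y‖ ^ 2 ≤
      (D : ℝ) ^ X.card * ∑ z, if ∀ j ∉ X, x j = z j then ‖O z y‖ ^ 2 else 0 := by
    intro x y
    rw [Matrix.mul_apply]
    calc ‖∑ z, H x z * O z y‖ ^ 2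
        ≤ (∑ z, ‖H x z‖ * (if ∀ j ∉ X, x j = z j then ‖O z y‖ else 0)) ^ 2 := by
          gcongr
          refine (norm_sum_le _ _).trans (Finset.sum_le_sum fun z _ => ?_)
          split_ifs with h
          · rw [norm_mul]
          · rw [apply_eq_zero_of_forall_trivial hH h]; simp
      _ ≤ (∑ z, ‖H x z‖ ^ 2) * ∑ z, (if ∀ j ∉ X, x j = z j then ‖O z y‖ else 0) ^ 2 :=
          Finset.sum_mul_sq_le_sq_mul_sq _ _ _
      _ ≤ _ := by
          refine mul_le_mul (sum_row_sq_le hD hH hnorm x) (le_of_eq ?_)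
            (Finset.sum_nonneg fun _ _ => sq_nonneg _) (by positivity)
          exact Finset.sum_congr rfl fun z _ => by split_ifs <;> simp
  calc ∑ x, ∑ y, ‖(H * O) x y‖ ^ 2
      ≤ ∑ x, ∑ y, (D : ℝ) ^ X.card *
          ∑ z, (if ∀ j ∉ X, x j = z j then ‖O z y‖ ^ 2 else 0) :=
        Finset.sum_le_sum fun x _ => Finset.sum_le_sum fun y _ => hentry x y
    _ = (D : ℝ) ^ X.card * ∑ z, ∑ y,
          ((Finset.univ.filter fun x : Config d => ∀ j ∉ X, x j = z j).card : ℝ) *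
            ‖O z y‖ ^ 2 := by
        simp only [← Finset.mul_sum]
        congr 1
        rw [Finset.sum_comm]
        rw [Finset.sum_congr rfl fun y _ => Finset.sum_comm]
        rw [Finset.sum_comm]
        refine Finset.sum_congr rfl fun z _ => ?_
        rw [Finset.mul_sum]
        refine Finset.sum_congr rfl fun y _ => ?_
        rw [← Finset.sum_filter, Finset.sum_const, nsmul_eq_mul]
    _ ≤ (D : ℝ) ^ X.card * ∑ z, ∑ y, (D : ℝ) ^ X.card * ‖O z y‖ ^ 2 := by
        gcongr with z _ y _
        exact_mod_cast card_agree_compl_le (X := X) hD z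
    _ = ((D : ℝ) ^ X.card) ^ 2 * ∑ z, ∑ y, ‖O z y‖ ^ 2 := by
        simp only [← Finset.mul_sum]
        ring

/-- An operator is close to one that is trivial on `X` when its components that act on the sites
of `X` are small. -/
theorem exists_trivial_norm_sub_le (X : Finset (Fin N)) (O : Op d) :
    ∃ O' : Op d, (∀ j ∈ X, trivialPart j O' = O') ∧
      ‖vec (O - O')‖ ≤ ∑ j ∈ X, ‖vec (proj j O)‖ := by
  induction X using Finset.induction_on with
  | empty => exact ⟨O, by simp, by simp⟩
  | insert j X hj ih =>
    obtain ⟨O', hO', hle⟩ := ih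
    refine ⟨trivialPart j O', fun i hi => ?_, ?_⟩
    · rcases eq_or_ne i j with rfl | hij
      · exact trivialPart_trivialPart _ _
      · rw [trivialPart_comm hij, hO' i ((Finset.mem_insert.1 hi).resolve_left hij)]
    · rw [Finset.sum_insert hj]
      have h : O - trivialPart j O' = proj j O + trivialPart j (O - O') := by
        simp only [proj, LinearMap.sub_apply, LinearMap.id_apply, map_sub]
        abel
      rw [h, map_add]
      exact (norm_add_le _ _).trans
        (add_le_add_right ((norm_vec_trivialPart_le _ _).trans hle) _)

/-- The commutator with a normalized local operator only sees the components of `O` that act on its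
support. -/
theorem norm_vec_liouvillian_le {X : Finset (Fin N)} {D : ℕ} (hD : ∀ v, d v ≤ D) {H : Op d}
    (hloc : IsLocalOn X H) (hnorm : opInner H H = 1) (O : Op d) :
    ‖vec (liouvillian H O)‖ ≤ 2 * (D : ℝ) ^ X.card * ∑ j ∈ X, ‖vec (proj j O)‖ := by
  have hH : ∀ j ∉ X, trivialPart j H = H := fun j hj => hloc.trivialPart_eq hj
  have hnorm' : ‖vec H‖ ^ 2 = Fintype.card (Config d) := by
    rw [opInner_self hloc.1] at hnorm
    exact eq_of_div_eq_one hnorm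
  obtain ⟨O', hO', hle⟩ := exists_trivial_norm_sub_le X O
  have h : liouvillian H O = Complex.I • (H * (O - O') - (O - O') * H) := by
    simp only [liouvillian, LinearMap.smul_apply, LinearMap.sub_apply, LinearMap.mulLeft_apply,
      LinearMap.mulRight_apply, mul_sub, sub_mul, commute_of_forall_trivial hH hO']
    congr 1
    abel
  have hright : ‖vec ((O - O') * H)‖ = ‖vec (H * (O - O').conjTranspose)‖ := by
    rw [← norm_vec_conjTranspose, Matrix.conjTranspose_mul, hloc.1.eq]
  rw [h, map_smul, norm_smul, Complex.norm_I, one_mul, map_sub]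
  calc ‖vec (H * (O - O')) - vec ((O - O') * H)‖
      ≤ (D : ℝ) ^ X.card * ‖vec (O - O')‖ + (D : ℝ) ^ X.card * ‖vec (O - O').conjTranspose‖ := by
        refine (norm_sub_le _ _).trans (add_le_add (norm_vec_mul_le hD hH hnorm' _) ?_)
        rw [hright]
        exact norm_vec_mul_le hD hH hnorm' _
    _ = 2 * (D : ℝ) ^ X.card * ‖vec (O - O')‖ := by rw [norm_vec_conjTranspose]; ring
    _ ≤ _ := by gcongr

/-! ### Heisenberg evolution -/

theorem liouvillian_add (H K : Op d) : liouvillian (H + K) = liouvillian H + liouvillian K := by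
  ext1 O
  simp only [liouvillian, LinearMap.smul_apply, LinearMap.sub_apply, LinearMap.add_apply,
    LinearMap.mulLeft_apply, LinearMap.mulRight_apply, add_mul, mul_add]
  module

theorem liouvillian_smul (a : ℂ) (H : Op d) : liouvillian (a • H) = a • liouvillian H := by
  ext1 O
  simp only [liouvillian, LinearMap.smul_apply, LinearMap.sub_apply,
    LinearMap.mulLeft_apply, LinearMap.mulRight_apply, smul_mul_assoc, mul_smul_comm]
  module

/-- The Liouvillian of `H` as a bounded operator on the Hilbert–Schmidt space, as a linear function
of `H`. -/
noncomputable def generator : Op d →ₗ[ℂ]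
    (EuclideanSpace ℂ (Config d × Config d) →L[ℂ] EuclideanSpace ℂ (Config d × Config d)) where
  toFun H := LinearMap.toContinuousLinearMap
    (vec.toLinearMap ∘ₗ liouvillian H ∘ₗ vec.symm.toLinearMap)
  map_add' H K := by ext1 x; simp [liouvillian_add]
  map_smul' a H := by ext1 x; simp [liouvillian_smul]

theorem generator_vec (H O : Op d) : generator H (vec O) = vec (liouvillian H O) := by
  simp [generator]

theorem vec_smul_liouvillian_pow (H : Op d) (t : ℝ) (O : Op d) (n : ℕ) :
    vec ((((t : ℂ) • liouvillian H) ^ n) O) = ((t • generator H) ^ n) (vec O) := by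
  induction n with
  | zero => simp
  | succ n ih =>
    rw [pow_succ', pow_succ', Module.End.mul_apply, LinearMap.smul_apply, map_smul,
      ← generator_vec, ih, mul_apply_eq_comp, smul_apply, Complex.coe_smul]

theorem hasSum_exp_apply {E : Type*} [NormedAddCommGroup E] [NormedSpace ℂ E] [CompleteSpace E]
    (f : E →L[ℂ] E) (x : E) :
    HasSum (fun n : ℕ => ((n.factorial : ℂ))⁻¹ • (f ^ n) x) (NormedSpace.exp f x) := by
  let _ : NormedAlgebra ℚ (E →L[ℂ] E) := NormedAlgebra.restrictScalars ℚ ℂ _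
  have h := NormedSpace.exp_series_hasSum_exp' (𝕂 := ℂ) f
  simpa using (ContinuousLinearMap.apply ℂ E x).hasSum h

theorem vec_evolve (H : Op d) (t : ℝ) (O : Op d) :
    vec (evolve H t O) = NormedSpace.exp (t • generator H) (vec O) := by
  have hcont : Continuous (vec : Op d ≃ₗ[ℂ] _) :=
    LinearMap.continuous_of_finiteDimensional (vec (d := d)).toLinearMap
  have h1 := (hasSum_evolve H t O).map (vec : Op d ≃ₗ[ℂ] _) hcont
  rw [← evolve_eq] at h1
  have heq : (vec : Op d ≃ₗ[ℂ] _) ∘ (fun n : ℕ => ((n.factorial : ℂ))⁻¹ •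
      (((t : ℂ) • liouvillian H) ^ n) O) =
      fun n : ℕ => ((n.factorial : ℂ))⁻¹ • ((t • generator H) ^ n) (vec O) := by
    funext n
    rw [Function.comp_apply, map_smul, vec_smul_liouvillian_pow]
  rw [heq] at h1
  exact h1.unique (hasSum_exp_apply _ _)

theorem continuous_vec_evolve (A : Op d) :
    Continuous fun p : ℝ × Op d => vec (evolve p.2 p.1 A) := by
  let _ : NormedAlgebra ℚ (EuclideanSpace ℂ (Config d × Config d) →L[ℂ]
    EuclideanSpace ℂ (Config d × Config d)) := NormedAlgebra.restrictScalars ℚ ℂ _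
  have hg : Continuous (generator (d := d)) := LinearMap.continuous_of_finiteDimensional _
  simp only [vec_evolve]
  have h : Continuous fun p : ℝ × Op d => NormedSpace.exp (p.1 • generator p.2) :=
    NormedSpace.exp_continuous.comp (continuous_fst.smul (hg.comp continuous_snd))
  exact h.clm_apply continuous_const

theorem conjTranspose_exp {H : Op d} (hH : H.IsHermitian) (t : ℝ) :
    (NormedSpace.exp ((t * Complex.I) • H)).conjTranspose =
      NormedSpace.exp (-((t * Complex.I) • H)) := by
  rw [← Matrix.exp_conjTranspose, Matrix.conjTranspose_smul, hH.eq]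
  simp

theorem exp_mul_exp_neg (H : Op d) : NormedSpace.exp H * NormedSpace.exp (-H) = 1 := by
  rw [← Matrix.exp_add_of_commute _ _ (Commute.neg_right (Commute.refl H)), add_neg_cancel,
    NormedSpace.exp_zero]

theorem norm_vec_evolve {H : Op d} (hH : H.IsHermitian) (t : ℝ) (O : Op d) :
    ‖vec (evolve H t O)‖ = ‖vec O‖ := by
  have h := exp_mul_exp_neg (-((t * Complex.I) • H))
  rw [neg_neg] at h
  rw [evolve_eq]
  refine norm_vec_conj ?_ ?_ O
  · rw [conjTranspose_exp hH, h]
  · rw [← conjTranspose_exp hH, Matrix.conjTranspose_conjTranspose, conjTranspose_exp hH, h]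

theorem isHermitian_evolve {H A : Op d} (hH : H.IsHermitian) (hA : A.IsHermitian) (t : ℝ) :
    (evolve H t A).IsHermitian := by
  rw [evolve_eq, ← conjTranspose_exp hH]
  simp [Matrix.IsHermitian, Matrix.conjTranspose_mul, hA.eq, Matrix.mul_assoc]

/-- An operator never reaches a site on which the Hamiltonian acts trivially. -/
theorem proj_evolve_eq_zero {j : Fin N} {H A : Op d} (hH : trivialPart j H = H)
    (hA : proj j A = 0) (t : ℝ) : proj j (evolve H t A) = 0 := by
  have hcont : Continuous (proj (d := d) j) := LinearMap.continuous_of_finiteDimensional _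
  have h := (hasSum_evolve H t A).map (proj j) hcont
  rw [← evolve_eq] at h
  have hpow : ∀ n : ℕ, proj j ((((t : ℂ) • liouvillian H) ^ n) A) = 0 := by
    intro n
    induction n with
    | zero => simpa using hA
    | succ n ih =>
      rw [pow_succ', Module.End.mul_apply, LinearMap.smul_apply, map_smul, proj_liouvillian hH, ih]
      simp
  refine h.unique ?_
  simp [Function.comp_def, hpow]

/-- Duhamel's formula, with the norm of the outer evolution removed by unitarity. -/
theorem norm_vec_evolve_sub_le {H K : Op d} (hH : H.IsHermitian) (A : Op d) {t : ℝ} (ht : 0 ≤ t) :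
    ‖vec (evolve H t A - evolve K t A)‖ ≤
      ∫ s in (0 : ℝ)..t, ‖vec (liouvillian (H - K) (evolve K s A))‖ := by
  let _ : NormedAlgebra ℚ (EuclideanSpace ℂ (Config d × Config d) →L[ℂ]
    EuclideanSpace ℂ (Config d × Config d)) := NormedAlgebra.restrictScalars ℚ ℂ _
  set a := generator H
  set b := generator K
  set x := vec A
  have hcont : Continuous fun s : ℝ =>
      NormedSpace.exp ((t - s) • a) ((b - a) (NormedSpace.exp (s • b) x)) := by
    have h1 : Continuous fun s : ℝ => NormedSpace.exp ((t - s) • a) :=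
      NormedSpace.exp_continuous.comp (by fun_prop)
    have h2 : Continuous fun s : ℝ => NormedSpace.exp (s • b) :=
      NormedSpace.exp_continuous.comp (by fun_prop)
    exact h1.clm_apply (continuous_const.clm_apply (h2.clm_apply continuous_const))
  have hderiv : ∀ s : ℝ, HasDerivAt
      (fun s : ℝ => (NormedSpace.exp ((t - s) • a) * NormedSpace.exp (s • b)) x)
      (NormedSpace.exp ((t - s) • a) ((b - a) (NormedSpace.exp (s • b) x))) s := by
    intro s
    have h1 : HasDerivAt (fun s : ℝ => NormedSpace.exp ((t - s) • a))
        ((-1 : ℝ) • (NormedSpace.exp ((t - s) • a) * a)) s :=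
      HasDerivAt.scomp s (hasDerivAt_exp_smul_const a (t - s)) ((hasDerivAt_id s).const_sub t)
    have h2 := ((ContinuousLinearMap.apply ℂ (EuclideanSpace ℂ (Config d × Config d))
      x).restrictScalars ℝ).hasFDerivAt.comp_hasDerivAt s
        (h1.mul (hasDerivAt_exp_smul_const' b s))
    refine h2.congr_deriv ?_
    simp [mul_apply_eq_comp]
    abel
  have hint := intervalIntegral.integral_eq_sub_of_hasDerivAt (a := 0) (b := t)
    (fun s _ => hderiv s) (hcont.intervalIntegrable _ _)
  simp only [sub_self, zero_smul ℝ a, zero_smul ℝ b, NormedSpace.exp_zero, sub_zero, one_mul,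
    mul_one] at hint
  have hnorm : ∀ s, ‖NormedSpace.exp ((t - s) • a) ((b - a) (NormedSpace.exp (s • b) x))‖ =
      ‖vec (liouvillian (H - K) (evolve K s A))‖ := by
    intro s
    rw [← vec_evolve, ← map_sub, generator_vec, ← vec_evolve, norm_vec_evolve hH,
      ← neg_sub H K, ← neg_one_smul ℂ (H - K), liouvillian_smul]
    simp
  rw [map_sub, vec_evolve, vec_evolve, norm_sub_rev]
  simp only [← hnorm]
  rw [← hint]
  exact intervalIntegral.norm_integral_le_integral_norm ht

/-- A Cauchy–Schwarz inequality with an exponential weight, which costs a factor `exp t` but no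
power of `t`. -/
theorem sq_integral_le_integral_exp_mul_sq {γ : ℝ → ℝ} (hγ : Continuous γ) (t : ℝ) (ht : 0 ≤ t) :
    (∫ s in (0 : ℝ)..t, γ s) ^ 2 ≤ ∫ s in (0 : ℝ)..t, Real.exp (t - s) * γ s ^ 2 := by
  set I := ∫ s in (0 : ℝ)..t, γ s with hI
  have hc1 : Continuous fun s => Real.exp (t - s) * γ s ^ 2 := by fun_prop
  have hc2 : Continuous fun s => I ^ 2 * Real.exp (s - t) := by fun_prop
  have hexp : ∫ s in (0 : ℝ)..t, Real.exp (s - t) = 1 - Real.exp (-t) := by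
    rw [intervalIntegral.integral_comp_sub_right (fun s => Real.exp s), integral_exp]
    simp
  have hmono : ∫ s in (0 : ℝ)..t, 2 * I * γ s ≤
      ∫ s in (0 : ℝ)..t, (Real.exp (t - s) * γ s ^ 2 + I ^ 2 * Real.exp (s - t)) := by
    refine intervalIntegral.integral_mono_on ht ((by fun_prop : Continuous _).intervalIntegrable _ _)
      ((hc1.add hc2).intervalIntegrable _ _) fun s _ => ?_
    have h1 : Real.exp (t - s) * Real.exp (s - t) = 1 := by
      rw [← Real.exp_add]; simp
    have h2 : 0 < Real.exp (t - s) := Real.exp_pos _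
    -- the square `exp (s - t) * (exp (t - s) * γ s - I) ^ 2` is nonnegative
    have h3 : 0 ≤ Real.exp (s - t) * (Real.exp (t - s) * γ s - I) ^ 2 := by positivity
    have h4 : Real.exp (s - t) * (Real.exp (t - s) * γ s - I) ^ 2 =
        (Real.exp (t - s) * Real.exp (s - t)) * (Real.exp (t - s) * γ s ^ 2)
          - 2 * I * γ s * (Real.exp (t - s) * Real.exp (s - t)) + I ^ 2 * Real.exp (s - t) := by
      ring
    rw [h4, h1] at h3
    linarith
  rw [intervalIntegral.integral_const_mul, intervalIntegral.integral_add
    (hc1.intervalIntegrable _ _) (hc2.intervalIntegrable _ _),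
    intervalIntegral.integral_const_mul, hexp, ← hI] at hmono
  nlinarith [mul_nonneg (sq_nonneg I) (Real.exp_pos (-t)).le]

/-- The weight of `A(s)` on a site `j` where `A` and `K` act trivially, at any time `s ≤ t`, is
controlled by the part `H - K` of the Hamiltonian acting on the evolution under `K`. -/
theorem norm_vec_proj_evolve_sq_le {j : Fin N} {H K A : Op d} (hH : H.IsHermitian)
    (hK : trivialPart j K = K) (hA : proj j A = 0) {s t : ℝ} (hs : 0 ≤ s) (hst : s ≤ t) :
    ENNReal.ofReal (‖vec (proj j (evolve H s A))‖ ^ 2) ≤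
      ∫⁻ u in Set.Ioc 0 t, ENNReal.ofReal
        (Real.exp (t - u) * ‖vec (liouvillian (H - K) (evolve K u A))‖ ^ 2) := by
  set γ : ℝ → ℝ := fun u => ‖vec (liouvillian (H - K) (evolve K u A))‖ with hγdef
  have hγ : Continuous γ := by
    simp only [hγdef, ← generator_vec]
    have h := (continuous_vec_evolve A).comp (Continuous.prodMk continuous_id continuous_const :
      Continuous fun u : ℝ => (u, K))
    exact ((generator (H - K)).continuous.comp h).norm
  have h1 : ‖vec (proj j (evolve H s A))‖ ≤ ∫ u in (0 : ℝ)..s, γ u := by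
    have : proj j (evolve H s A) = proj j (evolve H s A - evolve K s A) := by
      rw [map_sub, proj_evolve_eq_zero hK hA, sub_zero]
    rw [this]
    exact (norm_vec_proj_le _ _).trans (norm_vec_evolve_sub_le hH A hs)
  have h2 : ‖vec (proj j (evolve H s A))‖ ^ 2 ≤
      ∫ u in (0 : ℝ)..s, Real.exp (s - u) * γ u ^ 2 :=
    (pow_le_pow_left₀ (norm_nonneg _) h1 2).trans (sq_integral_le_integral_exp_mul_sq hγ s hs)
  have hc : Continuous fun u => Real.exp (s - u) * γ u ^ 2 := by fun_prop
  rw [intervalIntegral.integral_of_le hs] at h2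
  refine (ENNReal.ofReal_le_ofReal h2).trans ?_
  rw [ofReal_integral_eq_lintegral_ofReal (hc.integrableOn_Ioc)
    (Filter.Eventually.of_forall fun u => by positivity)]
  refine (lintegral_mono_set (Set.Ioc_subset_Ioc_right hst)).trans (lintegral_mono fun u => ?_)
  gcongr

/-! ### Second moments of sums with independent mean-zero coefficients -/

section ProductMeasure

variable {ι : Type*} [Fintype ι] {μ : ι → Measure ℝ} [∀ a, IsProbabilityMeasure (μ a)]

/-- A coordinate is independent of the functions that do not depend on it. -/
theorem integral_pi_mul_of_update [DecidableEq ι] (a : ι) {φ : ℝ → ℝ} (hφ : Measurable φ)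
    {g : (ι → ℝ) → ℝ} (hg : Measurable g) (hga : ∀ J y, g (Function.update J a y) = g J) :
    ∫ J, φ (J a) * g J ∂(Measure.pi μ) = (∫ x, φ x ∂(μ a)) * ∫ J, g J ∂(Measure.pi μ) := by
  have hind : ProbabilityTheory.iIndepFun (fun (i : ι) (J : ι → ℝ) => J i) (Measure.pi μ) :=
    ProbabilityTheory.iIndepFun_pi (X := fun _ x => x) fun _ => aemeasurable_id
  have h1 := hind.indepFun_finset {a} {a}ᶜ disjoint_compl_right fun i => measurable_pi_apply i
  -- `g` is a function of the other coordinates, evaluated on their extension by zero.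
  let ext : (({a}ᶜ : Finset ι) → ℝ) → ι → ℝ :=
    fun r i => if h : i ∈ ({a}ᶜ : Finset ι) then r ⟨i, h⟩ else 0
  have hext : Measurable ext := by
    refine measurable_pi_lambda _ fun i => ?_
    by_cases h : i ∈ ({a}ᶜ : Finset ι)
    · simp only [ext, dif_pos h]; exact measurable_pi_apply _
    · simp only [ext, dif_neg h]; exact measurable_const
  have h2 := h1.comp (φ := fun r : ({a} : Finset ι) → ℝ => φ (r ⟨a, Finset.mem_singleton_self a⟩))
    (ψ := g ∘ ext) (hφ.comp (measurable_pi_apply _)) (hg.comp hext)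
  have hga' : ∀ J : ι → ℝ, g (ext fun i => J i) = g J := by
    intro J
    rw [← hga J 0]
    congr 1
    funext i
    by_cases h : i = a
    · subst h; simp [ext]
    · simp [ext, h]
  have h3 := h2.integral_mul_eq_mul_integral
    ((hφ.comp (measurable_pi_apply a)).aestronglyMeasurable)
    (((hg.comp hext).comp
      (measurable_pi_lambda _ fun i => measurable_pi_apply i.1)).aestronglyMeasurable)
  simp only [Pi.mul_apply, Function.comp_apply, hga'] at h3
  rw [h3]
  congr 1
  have hmp := measurePreserving_eval μ a
  rw [← hmp.map_eq, integral_map hmp.measurable.aemeasurable hφ.aestronglyMeasurable]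

theorem memLp_two_coordinate (hμ : ∀ a, Integrable (fun x : ℝ => x ^ 2) (μ a)) (a : ι) :
    MemLp (fun J : ι → ℝ => J a) 2 (Measure.pi μ) := by
  rw [memLp_two_iff_integrable_sq (measurable_pi_apply a).aestronglyMeasurable]
  exact (measurePreserving_eval μ a).integrable_comp_of_integrable (hμ a)

/-- Sums with independent mean-zero coefficients of vectors that do not depend on these
coefficients have no cross terms in their second moment. -/
theorem integral_norm_sum_smul_sq_le {E : Type*} [NormedAddCommGroup E] [InnerProductSpace ℂ E]
    {v : ℝ} (hint : ∀ a, Integrable (fun x : ℝ => x ^ 2) (μ a))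
    (hvar : ∀ a, ∫ x, x ^ 2 ∂(μ a) ≤ v) (hmean : ∀ a, ∫ x, x ∂(μ a) = 0)
    (F : Finset ι) {Z : ι → (ι → ℝ) → E} (hZ : ∀ a ∈ F, Continuous (Z a)) {B : ℝ}
    (hB : ∀ a ∈ F, ∀ J, ‖Z a J‖ ≤ B)
    (hZF : ∀ a ∈ F, ∀ J J' : ι → ℝ, (∀ b ∉ F, J b = J' b) → Z a J = Z a J') :
    Integrable (fun J => ‖∑ a ∈ F, (J a : ℂ) • Z a J‖ ^ 2) (Measure.pi μ) ∧
      ∫ J, ‖∑ a ∈ F, (J a : ℂ) • Z a J‖ ^ 2 ∂(Measure.pi μ) ≤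
        v * ∑ a ∈ F, ∫ J, ‖Z a J‖ ^ 2 ∂(Measure.pi μ) := by
  classical
  set c : ι → ι → (ι → ℝ) → ℝ := fun a b J => (inner ℂ (Z a J) (Z b J)).re with hc
  have hcm : ∀ a ∈ F, ∀ b ∈ F, Continuous (c a b) := fun a ha b hb =>
    Complex.continuous_re.comp ((hZ a ha).inner (hZ b hb))
  have hcB : ∀ a ∈ F, ∀ b ∈ F, ∀ J, ‖c a b J‖ ≤ B * B := by
    intro a ha b hb J
    refine (Complex.abs_re_le_norm _).trans ((norm_inner_le_norm _ _).trans ?_)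
    exact mul_le_mul (hB a ha J) (hB b hb J) (norm_nonneg _)
      ((norm_nonneg _).trans (hB a ha J))
  have hexpand : ∀ J : ι → ℝ, ‖∑ a ∈ F, (J a : ℂ) • Z a J‖ ^ 2 =
      ∑ a ∈ F, ∑ b ∈ F, J a * J b * c a b J := by
    intro J
    rw [← inner_self_eq_norm_sq (𝕜 := ℂ), sum_inner]
    simp only [inner_sum, inner_smul_left, inner_smul_right, Complex.conj_ofReal, map_sum]
    refine Finset.sum_congr rfl fun a _ => Finset.sum_congr rfl fun b _ => ?_
    simp [hc]
    ring
  have hintab : ∀ a ∈ F, ∀ b ∈ F, Integrable (fun J => J a * J b * c a b J) (Measure.pi μ) := by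
    intro a ha b hb
    have h1 : Integrable (fun J : ι → ℝ => J a * J b) (Measure.pi μ) :=
      (memLp_two_coordinate hint a).integrable_mul (memLp_two_coordinate hint b)
    exact h1.mul_bdd (c := B * B) (hcm a ha b hb).measurable.aestronglyMeasurable
      (Filter.Eventually.of_forall (hcB a ha b hb))
  have hupd : ∀ a ∈ F, ∀ (J : ι → ℝ) (y : ℝ), ∀ b ∉ F, Function.update J a y b = J b :=
    fun a ha J y b hb => Function.update_of_ne (fun h => hb (by rwa [h])) _ _
  have hoff : ∀ a ∈ F, ∀ b ∈ F, a ≠ b → ∫ J, J a * J b * c a b J ∂(Measure.pi μ) = 0 := by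
    intro a ha b hb hab
    have h := integral_pi_mul_of_update (μ := μ) a (φ := fun x => x) measurable_id
      (g := fun J => J b * c a b J)
      ((measurable_pi_apply b).mul (hcm a ha b hb).measurable) (fun J y => by
        simp only [hc]
        rw [hZF a ha _ J (hupd a ha J y), hZF b hb _ J (hupd a ha J y),
          Function.update_of_ne hab.symm])
    rw [hmean, zero_mul] at h
    rw [← h]
    simp only [mul_assoc]
  have hdiag : ∀ a ∈ F, ∫ J, J a * J a * c a a J ∂(Measure.pi μ) =
      (∫ x, x ^ 2 ∂(μ a)) * ∫ J, ‖Z a J‖ ^ 2 ∂(Measure.pi μ) := by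
    intro a ha
    have hn : ∀ J, c a a J = ‖Z a J‖ ^ 2 := fun J => inner_self_eq_norm_sq (𝕜 := ℂ) _
    rw [← integral_pi_mul_of_update (μ := μ) a (φ := fun x => x ^ 2) (measurable_id.pow_const 2)
      (g := fun J => ‖Z a J‖ ^ 2) ((hZ a ha).norm.pow 2).measurable
      (fun J y => by rw [hZF a ha _ J (hupd a ha J y)])]
    simp only [hn, sq]
  simp only [hexpand]
  refine ⟨integrable_finsetSum _ fun a ha => integrable_finsetSum _ fun b hb =>
    hintab a ha b hb, ?_⟩
  rw [integral_finsetSum _ fun a ha => integrable_finsetSum _ fun b hb => hintab a ha b hb,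
    Finset.mul_sum]
  refine Finset.sum_le_sum fun a ha => ?_
  rw [integral_finsetSum _ fun b hb => hintab a ha b hb, Finset.sum_eq_single a
    (fun b hb hba => hoff a ha b hb hba.symm) (fun h => absurd ha h), hdiag a ha]
  exact mul_le_mul_of_nonneg_right (hvar a) (integral_nonneg fun J => sq_nonneg _)

end ProductMeasure

/-! ### Evolution without the factors that touch a set of sites -/

-- Only the lemmas about `vec` and `evolve` are used from here on; unfolding them is expensive.
attribute [local irreducible] vec evolve

namespace SimpleEnsemble

variable {q m : ℕ} {G : FactorGraph N q m}

/-- The couplings with those of the factors that meet `R` switched off. -/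
noncomputable def cut (R : Finset (Fin N)) (J : {X // X ∈ G} → ℝ) : {X // X ∈ G} → ℝ :=
  fun X => if Disjoint X.1.1.1 R then J X else 0

/-- The factors that contain the site `j` and do not meet `R`. -/
def touching (G : FactorGraph N q m) (R : Finset (Fin N)) (j : Fin N) : Finset {X // X ∈ G} :=
  Finset.univ.filter fun X => j ∈ X.1.1.1 ∧ Disjoint X.1.1.1 R

/-- The operator `A` evolved for the time `t` without the factors that meet `R`. -/
noncomputable def evolved (E : SimpleEnsemble d G) (A : Op d) (R : Finset (Fin N)) (t : ℝ)
    (J : {X // X ∈ G} → ℝ) : Op d :=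
  evolve (E.hamiltonian (cut R J)) t A

/-- The action of the factors that contain `j` and do not meet `R` on the operator evolved without
them, up to the time `t`. It is the source term in Duhamel's formula for the weight on `j`. -/
noncomputable def influx (E : SimpleEnsemble d G) (A : Op d) (R : Finset (Fin N)) (j : Fin N)
    (t : ℝ) (J : {X // X ∈ G} → ℝ) : EuclideanSpace ℂ (Config d × Config d) :=
  ∑ X ∈ touching G R j, (J X : ℂ) • vec (liouvillian (E.term X) (E.evolved A (insert j R) t J))

/-- The exponentially weighted accumulated influx, a bound for the weight on the site `j` at all
times up to `t`. -/
noncomputable def cumulativeInflux (E : SimpleEnsemble d G) (A : Op d) (R : Finset (Fin N))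
    (j : Fin N) (t : ℝ) (J : {X // X ∈ G} → ℝ) : ENNReal :=
  ∫⁻ u in Set.Ioc 0 t, ENNReal.ofReal (Real.exp (t - u) * ‖E.influx A R j u J‖ ^ 2)

variable (E : SimpleEnsemble d G)

theorem cut_empty (J : {X // X ∈ G} → ℝ) : cut ∅ J = J := by
  funext X; simp [cut]

theorem isHermitian_hamiltonian (J : {X // X ∈ G} → ℝ) : (E.hamiltonian J).IsHermitian := by
  rw [Matrix.IsHermitian, hamiltonian, Matrix.conjTranspose_sum]
  refine Finset.sum_congr rfl fun X _ => ?_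
  rw [Matrix.conjTranspose_smul, (E.isLocal X).1.eq]
  simp

theorem trivialPart_hamiltonian_cut {R : Finset (Fin N)} {j : Fin N} (hj : j ∈ R)
    (J : {X // X ∈ G} → ℝ) :
    trivialPart j (E.hamiltonian (cut R J)) = E.hamiltonian (cut R J) := by
  rw [hamiltonian, map_sum]
  refine Finset.sum_congr rfl fun X _ => ?_
  rw [map_smul]
  by_cases h : Disjoint X.1.1.1 R
  · rw [(E.isLocal X).trivialPart_eq (Finset.disjoint_right.1 h hj)]
  · simp [cut, h]

theorem hamiltonian_cut_sub (R : Finset (Fin N)) (j : Fin N) (J : {X // X ∈ G} → ℝ) :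
    E.hamiltonian (cut R J) - E.hamiltonian (cut (insert j R) J) =
      ∑ X ∈ touching G R j, (J X : ℂ) • E.term X := by
  rw [hamiltonian, hamiltonian, ← Finset.sum_sub_distrib, touching, Finset.sum_filter]
  refine Finset.sum_congr rfl fun X _ => ?_
  by_cases hj : j ∈ X.1.1.1 <;> by_cases hR : Disjoint X.1.1.1 R <;>
    simp [cut, hj, hR, Finset.disjoint_insert_right]

theorem influx_eq (A : Op d) (R : Finset (Fin N)) (j : Fin N) (t : ℝ) (J : {X // X ∈ G} → ℝ) :
    E.influx A R j t J = vec (liouvillian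
      (E.hamiltonian (cut R J) - E.hamiltonian (cut (insert j R) J))
      (E.evolved A (insert j R) t J)) := by
  rw [hamiltonian_cut_sub, influx, ← generator_vec, map_sum, sum_apply]
  refine Finset.sum_congr rfl fun X _ => ?_
  rw [map_smul, ← generator_vec]
  rfl

theorem continuous_hamiltonian_cut (R : Finset (Fin N)) :
    Continuous fun J : {X // X ∈ G} → ℝ => E.hamiltonian (cut R J) := by
  unfold hamiltonian
  refine continuous_finsetSum _ fun X _ => ?_
  refine Continuous.smul (Complex.continuous_ofReal.comp ?_) continuous_const
  unfold cut
  split_ifs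
  · exact continuous_apply X
  · exact continuous_const

theorem continuous_vec_evolved (A : Op d) (R : Finset (Fin N)) :
    Continuous fun p : ({X // X ∈ G} → ℝ) × ℝ => vec (E.evolved A R p.2 p.1) := by
  unfold evolved
  have h : Continuous fun p : ({X // X ∈ G} → ℝ) × ℝ => (p.2, E.hamiltonian (cut R p.1)) :=
    continuous_snd.prodMk ((E.continuous_hamiltonian_cut R).comp continuous_fst)
  exact (continuous_vec_evolve A).comp h

theorem continuous_vec_liouvillian_evolved (X : {X // X ∈ G}) (A : Op d) (R : Finset (Fin N)) :
    Continuous fun p : ({X // X ∈ G} → ℝ) × ℝ =>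
      vec (liouvillian (E.term X) (E.evolved A R p.2 p.1)) := by
  simp only [← generator_vec]
  exact (generator (E.term X)).continuous.comp (E.continuous_vec_evolved A R)

theorem continuous_influx (A : Op d) (R : Finset (Fin N)) (j : Fin N) :
    Continuous fun p : ({X // X ∈ G} → ℝ) × ℝ => E.influx A R j p.2 p.1 := by
  unfold influx
  refine continuous_finsetSum _ fun X _ => ?_
  have h1 := E.continuous_vec_liouvillian_evolved X A (insert j R)
  have h2 : Continuous fun p : ({X // X ∈ G} → ℝ) × ℝ => (p.1 X : ℂ) :=
    Complex.continuous_ofReal.comp ((continuous_apply X).comp continuous_fst)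
  exact h2.smul h1

theorem continuous_vec_proj_evolved (A : Op d) (R : Finset (Fin N)) (j : Fin N) (t : ℝ) :
    Continuous fun J : {X // X ∈ G} → ℝ => vec (proj j (E.evolved A R t J)) := by
  have h : Continuous (vec.toLinearMap ∘ₗ proj (d := d) j ∘ₗ vec.symm.toLinearMap) :=
    LinearMap.continuous_of_finiteDimensional _
  have h2 := h.comp ((E.continuous_vec_evolved A R).comp
    (continuous_id.prodMk (continuous_const (y := t))))
  simpa [Function.comp_def] using h2

theorem norm_vec_evolved (A : Op d) (R : Finset (Fin N)) (t : ℝ) (J : {X // X ∈ G} → ℝ) :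
    ‖vec (E.evolved A R t J)‖ = ‖vec A‖ :=
  norm_vec_evolve (E.isHermitian_hamiltonian _) t A

theorem integrable_norm_vec_proj_evolved_sq (A : Op d) (R : Finset (Fin N)) (j : Fin N) (t : ℝ) :
    Integrable (fun J => ‖vec (proj j (E.evolved A R t J))‖ ^ 2) E.couplingLaw := by
  have := E.isProb
  have : IsProbabilityMeasure E.couplingLaw := by unfold couplingLaw; infer_instance
  refine Integrable.of_bound
    ((E.continuous_vec_proj_evolved A R j t).norm.pow 2).measurable.aestronglyMeasurable
    (‖vec A‖ ^ 2) (Filter.Eventually.of_forall fun J => ?_)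
  rw [Real.norm_of_nonneg (sq_nonneg _), ← E.norm_vec_evolved A R t J]
  exact pow_le_pow_left₀ (norm_nonneg _) (norm_vec_proj_le _ _) 2

theorem norm_vec_proj_evolved_sq_le (A : Op d) {R : Finset (Fin N)} {j : Fin N}
    (hA : proj j A = 0) {s t : ℝ} (hs : 0 ≤ s) (hst : s ≤ t) (J : {X // X ∈ G} → ℝ) :
    ENNReal.ofReal (‖vec (proj j (E.evolved A R s J))‖ ^ 2) ≤ E.cumulativeInflux A R j t J := by
  unfold cumulativeInflux
  simp only [influx_eq]
  exact norm_vec_proj_evolve_sq_le (E.isHermitian_hamiltonian _)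
    (E.trivialPart_hamiltonian_cut (Finset.mem_insert_self j R) J) hA hs hst

theorem measurable_cumulativeInflux (A : Op d) (R : Finset (Fin N)) (j : Fin N) (t : ℝ) :
    Measurable (E.cumulativeInflux A R j t) := by
  unfold cumulativeInflux
  refine Measurable.lintegral_prod_right' (f := fun p : ({X // X ∈ G} → ℝ) × ℝ =>
    ENNReal.ofReal (Real.exp (t - p.2) * ‖E.influx A R j p.2 p.1‖ ^ 2)) ?_
  have h := E.continuous_influx A R j
  exact ENNReal.measurable_ofReal.comp (by fun_prop : Continuous _).measurable

theorem norm_vec_liouvillian_evolved_le {D : ℕ} (hD : ∀ v, d v ≤ D) (A : Op d)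
    {R : Finset (Fin N)} {j : Fin N} (hAj : proj j A = 0) (t : ℝ) (X : {X // X ∈ G})
    (J : {X // X ∈ G} → ℝ) :
    ‖vec (liouvillian (E.term X) (E.evolved A (insert j R) t J))‖ ≤
      2 * (D : ℝ) ^ q *
        ∑ x ∈ X.1.1.1.erase j, ‖vec (proj x (E.evolved A (insert j R) t J))‖ := by
  have hOj : proj j (E.evolved A (insert j R) t J) = 0 :=
    proj_evolve_eq_zero (E.trivialPart_hamiltonian_cut (Finset.mem_insert_self j R) J) hAj t
  have hnorm : opInner (E.term X) (E.term X) = 1 := by rw [E.orthonormal, if_pos rfl]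
  have h := norm_vec_liouvillian_le hD (E.isLocal X) hnorm (E.evolved A (insert j R) t J)
  rw [X.1.1.2] at h
  rwa [Finset.sum_erase]
  rw [hOj, map_zero, norm_zero]

theorem norm_vec_liouvillian_evolved_sq_le {D : ℕ} (hD : ∀ v, d v ≤ D) (A : Op d)
    {R : Finset (Fin N)} {j : Fin N} (hAj : proj j A = 0) (t : ℝ) (X : {X // X ∈ G})
    (J : {X // X ∈ G} → ℝ) :
    ‖vec (liouvillian (E.term X) (E.evolved A (insert j R) t J))‖ ^ 2 ≤
      (2 * (D : ℝ) ^ q) ^ 2 * q *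
        ∑ x ∈ X.1.1.1.erase j, ‖vec (proj x (E.evolved A (insert j R) t J))‖ ^ 2 := by
  refine (pow_le_pow_left₀ (norm_nonneg _)
    (E.norm_vec_liouvillian_evolved_le hD A hAj t X J) 2).trans ?_
  rw [mul_pow, mul_assoc]
  gcongr
  refine (sq_sum_le_card_mul_sum_sq).trans ?_
  gcongr
  exact (Finset.card_le_card (Finset.erase_subset _ _)).trans X.1.1.2.le

theorem norm_vec_liouvillian_evolved_le_const {D : ℕ} (hD : ∀ v, d v ≤ D) (A : Op d)
    {R : Finset (Fin N)} {j : Fin N} (hAj : proj j A = 0) (t : ℝ) (X : {X // X ∈ G})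
    (J : {X // X ∈ G} → ℝ) :
    ‖vec (liouvillian (E.term X) (E.evolved A (insert j R) t J))‖ ≤
      2 * (D : ℝ) ^ q * (N * ‖vec A‖) := by
  refine (E.norm_vec_liouvillian_evolved_le hD A hAj t X J).trans ?_
  gcongr
  calc ∑ x ∈ X.1.1.1.erase j, ‖vec (proj x (E.evolved A (insert j R) t J))‖
      ≤ ∑ x ∈ X.1.1.1.erase j, ‖vec A‖ := by
        refine Finset.sum_le_sum fun x _ => (norm_vec_proj_le _ _).trans ?_
        rw [E.norm_vec_evolved]
    _ ≤ ∑ _x : Fin N, ‖vec A‖ :=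
        Finset.sum_le_sum_of_subset_of_nonneg (Finset.subset_univ _) fun _ _ _ => norm_nonneg _
    _ = N * ‖vec A‖ := by simp

/-- The couplings of the factors that contain `j` have mean zero and are independent of the
evolution without these factors, so that only the diagonal terms contribute to the mean square of
the influx. -/
theorem integral_norm_influx_sq_le_sum {v : ℝ} (hv : E.VarianceLE v) {D : ℕ}
    (hD : ∀ v, d v ≤ D) (A : Op d) (R : Finset (Fin N)) {j : Fin N}
    (hAj : proj j A = 0) (t : ℝ) :
    Integrable (fun J => ‖E.influx A R j t J‖ ^ 2) E.couplingLaw ∧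
    ∫ J, ‖E.influx A R j t J‖ ^ 2 ∂E.couplingLaw ≤
      v * ∑ X ∈ touching G R j,
        ∫ J, ‖vec (liouvillian (E.term X) (E.evolved A (insert j R) t J))‖ ^ 2 ∂E.couplingLaw := by
  have := E.isProb
  have hcont : ∀ X, Continuous fun J : {X // X ∈ G} → ℝ =>
      vec (liouvillian (E.term X) (E.evolved A (insert j R) t J)) :=
    fun X => (E.continuous_vec_liouvillian_evolved X A (insert j R)).along_fst
  have hcut : ∀ J J' : {X // X ∈ G} → ℝ, (∀ Y ∉ touching G R j, J Y = J' Y) →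
      cut (insert j R) J = cut (insert j R) J' := by
    intro J J' hJ
    funext Y
    unfold cut
    split_ifs with hY
    · refine hJ Y fun hYt => ?_
      exact Finset.disjoint_right.1 hY (Finset.mem_insert_self j R) (Finset.mem_filter.1 hYt).2.1
    · rfl
  have hdep : ∀ X, ∀ J J' : {X // X ∈ G} → ℝ, (∀ Y ∉ touching G R j, J Y = J' Y) →
      vec (liouvillian (E.term X) (E.evolved A (insert j R) t J)) =
        vec (liouvillian (E.term X) (E.evolved A (insert j R) t J')) := by
    intro X J J' hJ
    unfold evolved
    rw [hcut J J' hJ]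
  exact integral_norm_sum_smul_sq_le (fun X => (hv X).1) (fun X => (hv X).2) E.mean_zero
    (touching G R j) (fun X _ => hcont X)
    (fun X _ J => E.norm_vec_liouvillian_evolved_le_const hD A hAj t X J) (fun X _ => hdep X)

theorem integral_norm_influx_sq_le {v : ℝ} (hv : E.VarianceLE v) (hv0 : 0 ≤ v) {D : ℕ}
    (hD : ∀ v, d v ≤ D) (A : Op d) (R : Finset (Fin N)) {j : Fin N}
    (hAj : proj j A = 0) (t : ℝ) :
    ∫ J, ‖E.influx A R j t J‖ ^ 2 ∂E.couplingLaw ≤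
      v * ((2 * (D : ℝ) ^ q) ^ 2 * q) * ∑ X ∈ touching G R j, ∑ x ∈ X.1.1.1.erase j,
        ∫ J, ‖vec (proj x (E.evolved A (insert j R) t J))‖ ^ 2 ∂E.couplingLaw := by
  refine (E.integral_norm_influx_sq_le_sum hv hD A R hAj t).2.trans ?_
  rw [mul_assoc v]
  refine mul_le_mul_of_nonneg_left ?_ hv0
  rw [Finset.mul_sum]
  refine Finset.sum_le_sum fun X _ => ?_
  rw [← integral_finsetSum _ fun x _ => E.integrable_norm_vec_proj_evolved_sq A _ x t,
    ← integral_const_mul]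
  exact integral_mono_of_nonneg (Filter.Eventually.of_forall fun J => sq_nonneg _)
    ((integrable_finsetSum _ fun x _ =>
      E.integrable_norm_vec_proj_evolved_sq A _ x t).const_mul _)
    (Filter.Eventually.of_forall fun J =>
      E.norm_vec_liouvillian_evolved_sq_le hD A hAj t X J)

end SimpleEnsemble

/-! ### Sums over self-avoiding paths of factors -/

section PathCount

variable {q m : ℕ}

/-- The number of paths with `l` steps from `j` to `i` that avoid `R`. A step from a site chooses a
factor of `G` that contains it and a different site of this factor; the factor must not meet `R` or
any site that has been left earlier. A path ends as soon as it reaches `i`, and the flavors of a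
factor are counted separately. -/
noncomputable def pathCount (G : FactorGraph N q m) (i : Fin N) :
    ℕ → Finset (Fin N) → Fin N → ℝ
  | 0, _, j => if j = i then 1 else 0
  | l + 1, R, j => if j = i then 0 else
      ∑ X ∈ G with j ∈ X.1.1 ∧ Disjoint X.1.1 R,
        ∑ x ∈ X.1.1.erase j, pathCount G i l (insert j R) x

theorem pathCount_nonneg (G : FactorGraph N q m) (i : Fin N) (l : ℕ) (R : Finset (Fin N))
    (j : Fin N) : 0 ≤ pathCount G i l R j := by
  induction l generalizing R j with
  | zero => unfold pathCount; split_ifs <;> simp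
  | succ l ih =>
    unfold pathCount
    split_ifs
    · exact le_rfl
    · exact Finset.sum_nonneg fun X _ => Finset.sum_nonneg fun x _ => ih _ _

/-- The factors that meet `R` do not contribute to the paths that avoid `R`. -/
theorem pathCount_insert (G : FactorGraph N q m) (i : Fin N) (l : ℕ) {R : Finset (Fin N)}
    (j : Fin N) {X : Factor N q m} (hX : ¬ Disjoint X.1.1 R) :
    pathCount (insert X G) i l R j = pathCount G i l R j := by
  induction l generalizing R j with
  | zero => rfl
  | succ l ih =>
    have hXR : ¬ (j ∈ X.1.1 ∧ Disjoint X.1.1 R) := fun h => hX h.2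
    unfold pathCount
    rw [Finset.filter_insert, if_neg hXR]
    have hX' : ¬ Disjoint X.1.1 (insert j R) := fun h =>
      hX (Finset.disjoint_of_subset_right (Finset.subset_insert _ _) h)
    simp only [ih _ hX']

/-- The sum over the paths with fewer than `n` factors, with weight `(a t) ^ l / l!` for a path of
`l` factors. -/
noncomputable def pathBound (G : FactorGraph N q m) (i : Fin N) (a : ℝ) (n : ℕ)
    (R : Finset (Fin N)) (j : Fin N) (t : ℝ) : ℝ :=
  ∑ l ∈ Finset.range n, a ^ l * t ^ l / (l.factorial : ℝ) * pathCount G i l R j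

theorem pathBound_nonneg (G : FactorGraph N q m) (i : Fin N) {a : ℝ} (ha : 0 ≤ a) (n : ℕ)
    (R : Finset (Fin N)) (j : Fin N) {t : ℝ} (ht : 0 ≤ t) : 0 ≤ pathBound G i a n R j t :=
  Finset.sum_nonneg fun l _ => mul_nonneg (by positivity) (pathCount_nonneg _ _ _ _ _)

theorem continuous_pathBound (G : FactorGraph N q m) (i : Fin N) (a : ℝ) (n : ℕ)
    (R : Finset (Fin N)) (j : Fin N) : Continuous (pathBound G i a n R j) := by
  unfold pathBound
  fun_prop

theorem sum_touching (G : FactorGraph N q m) (R : Finset (Fin N)) (j : Fin N)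
    (f : Factor N q m → ℝ) :
    ∑ X ∈ SimpleEnsemble.touching G R j, f X.1 =
      ∑ X ∈ G with j ∈ X.1.1 ∧ Disjoint X.1.1 R, f X := by
  rw [SimpleEnsemble.touching, Finset.sum_filter, Finset.sum_filter,
    ← Finset.sum_coe_sort G (fun X => if j ∈ X.1.1 ∧ Disjoint X.1.1 R then f X else 0)]

/-- The recursion for the path sums in integrated form. -/
theorem integral_sum_touching_pathBound (G : FactorGraph N q m) (i : Fin N) (a : ℝ) (n : ℕ)
    (R : Finset (Fin N)) {j : Fin N} (hj : j ≠ i) (t : ℝ) :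
    ∫ u in (0 : ℝ)..t, a * ∑ X ∈ SimpleEnsemble.touching G R j, ∑ x ∈ X.1.1.1.erase j,
      pathBound G i a n (insert j R) x u = pathBound G i a (n + 1) R j t := by
  have h1 : ∀ u, a * ∑ X ∈ SimpleEnsemble.touching G R j, ∑ x ∈ X.1.1.1.erase j,
      pathBound G i a n (insert j R) x u = ∑ l ∈ Finset.range n,
        a ^ (l + 1) / (l.factorial : ℝ) * pathCount G i (l + 1) R j * u ^ l := by
    intro u
    rw [sum_touching G R j (fun X => ∑ x ∈ X.1.1.erase j, pathBound G i a n (insert j R) x u)]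
    simp only [pathBound]
    rw [Finset.sum_congr rfl fun X _ => Finset.sum_comm, Finset.sum_comm, Finset.mul_sum]
    refine Finset.sum_congr rfl fun l _ => ?_
    rw [pathCount, if_neg hj]
    simp only [← Finset.mul_sum]
    ring
  simp only [h1]
  rw [intervalIntegral.integral_finsetSum fun l _ =>
    (by fun_prop : Continuous _).intervalIntegrable _ _, pathBound, Finset.sum_range_succ']
  simp only [intervalIntegral.integral_const_mul, integral_pow]
  rw [pathCount, if_neg hj, mul_zero, add_zero]
  refine Finset.sum_congr rfl fun l _ => ?_
  rw [Nat.factorial_succ]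
  push_cast
  have : (l.factorial : ℝ) ≠ 0 := by positivity
  field_simp
  simp

end PathCount

namespace SimpleEnsemble

variable {q m : ℕ} {G : FactorGraph N q m} (E : SimpleEnsemble d G)

/-- One step of the recursion: bounds without the factors at `j` for the weights on the other sites
give a bound for the influx at `j`. -/
theorem lintegral_cumulativeInflux_le_of_forall {v : ℝ} (hv : E.VarianceLE v) (hv0 : 0 ≤ v)
    {D : ℕ} (hD : ∀ v, d v ≤ D) {A : Op d} {i j : Fin N} (hij : j ≠ i) (hAj : proj j A = 0)
    {R : Finset (Fin N)} (n : ℕ) {M : ℝ} (hM : 0 ≤ M) {a : ℝ}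
    (ha : a = v * ((2 * (D : ℝ) ^ q) ^ 2 * q))
    (hR : ∀ x ∉ R, x ≠ j → ∀ u, 0 ≤ u →
      ∫ J, ‖vec (proj x (E.evolved A (insert j R) u J))‖ ^ 2 ∂E.couplingLaw ≤
        M * (Real.exp u * pathBound G i a n (insert j R) x u)) {t : ℝ} (ht : 0 ≤ t) :
    ∫⁻ J, E.cumulativeInflux A R j t J ∂E.couplingLaw ≤
      ENNReal.ofReal (M * (Real.exp t * pathBound G i a (n + 1) R j t)) := by
  have := E.isProb
  have hprob : IsProbabilityMeasure E.couplingLaw := by unfold couplingLaw; infer_instance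
  have ha0 : 0 ≤ a := by rw [ha]; positivity
  set S : ℝ → ℝ := fun u => a * ∑ X ∈ touching G R j, ∑ x ∈ X.1.1.1.erase j,
    pathBound G i a n (insert j R) x u with hS
  have hScont : Continuous S := by
    refine continuous_const.mul (continuous_finsetSum _ fun X _ =>
      continuous_finsetSum _ fun x _ => continuous_pathBound _ _ _ _ _ _)
  have hS0 : ∀ u, 0 ≤ u → 0 ≤ S u := fun u hu =>
    mul_nonneg ha0 (Finset.sum_nonneg fun X _ => Finset.sum_nonneg fun x _ =>
      pathBound_nonneg _ _ ha0 _ _ _ hu)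
  have hinflux : ∀ u, 0 ≤ u → ∫ J, ‖E.influx A R j u J‖ ^ 2 ∂E.couplingLaw ≤
      M * (Real.exp u * S u) := by
    intro u hu
    refine (E.integral_norm_influx_sq_le hv hv0 hD A R hAj u).trans ?_
    rw [← ha]
    calc a * ∑ X ∈ touching G R j, ∑ x ∈ X.1.1.1.erase j,
          ∫ J, ‖vec (proj x (E.evolved A (insert j R) u J))‖ ^ 2 ∂E.couplingLaw
        ≤ a * ∑ X ∈ touching G R j, ∑ x ∈ X.1.1.1.erase j,
          M * (Real.exp u * pathBound G i a n (insert j R) x u) := by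
          refine mul_le_mul_of_nonneg_left (Finset.sum_le_sum fun X hX =>
            Finset.sum_le_sum fun x hx => hR x ?_ (Finset.ne_of_mem_erase hx) u hu) ha0
          exact Finset.disjoint_left.1 (Finset.mem_filter.1 hX).2.2 (Finset.mem_of_mem_erase hx)
      _ = M * (Real.exp u * S u) := by
          simp only [hS, ← Finset.mul_sum]
          ring
  unfold cumulativeInflux
  have hmeas : Measurable fun p : ({X // X ∈ G} → ℝ) × ℝ =>
      ENNReal.ofReal (Real.exp (t - p.2) * ‖E.influx A R j p.2 p.1‖ ^ 2) := by
    have h := E.continuous_influx A R j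
    exact ENNReal.measurable_ofReal.comp (by fun_prop : Continuous _).measurable
  rw [lintegral_lintegral_swap hmeas.aemeasurable]
  have hinner : ∀ u ∈ Set.Ioc 0 t,
      ∫⁻ J, ENNReal.ofReal (Real.exp (t - u) * ‖E.influx A R j u J‖ ^ 2) ∂E.couplingLaw ≤
        ENNReal.ofReal (M * Real.exp t * S u) := by
    intro u hu
    have hint := (E.integral_norm_influx_sq_le_sum hv hD A R hAj u).1
    rw [← ofReal_integral_eq_lintegral_ofReal (hint.const_mul _)
      (Filter.Eventually.of_forall fun J => by positivity), integral_const_mul]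
    refine ENNReal.ofReal_le_ofReal ?_
    have hexp : Real.exp t = Real.exp (t - u) * Real.exp u := by rw [← Real.exp_add]; simp
    calc Real.exp (t - u) * ∫ J, ‖E.influx A R j u J‖ ^ 2 ∂E.couplingLaw
        ≤ Real.exp (t - u) * (M * (Real.exp u * S u)) :=
          mul_le_mul_of_nonneg_left (hinflux u hu.1.le) (Real.exp_pos _).le
      _ = M * Real.exp t * S u := by rw [hexp]; ring
  refine (setLIntegral_mono' measurableSet_Ioc hinner).trans (le_of_eq ?_)
  have hint : IntegrableOn (fun u => M * Real.exp t * S u) (Set.Ioc 0 t) :=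
    (by fun_prop : Continuous fun u => M * Real.exp t * S u).integrableOn_Ioc
  rw [← ofReal_integral_eq_lintegral_ofReal hint
    ((ae_restrict_iff' measurableSet_Ioc).2 (Filter.Eventually.of_forall fun u hu =>
      mul_nonneg (by positivity) (hS0 u hu.1.le))), integral_const_mul,
    ← intervalIntegral.integral_of_le ht, hS, integral_sum_touching_pathBound G i a n R hij t,
    mul_assoc]

/-- The mean weight on the site `j` is bounded by the sum over self-avoiding paths from `j` to the
site `i` of the initial operator. The induction removes the sites from the system one by one. -/
theorem integral_norm_vec_proj_evolved_sq_le {v : ℝ} (hv : E.VarianceLE v) (hv0 : 0 ≤ v)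
    {D : ℕ} (hD : ∀ v, d v ≤ D) {A : Op d} {i : Fin N} (hA : IsLocalOn {i} A) {a : ℝ}
    (ha : a = v * ((2 * (D : ℝ) ^ q) ^ 2 * q)) (n : ℕ) {R : Finset (Fin N)} {j : Fin N}
    (hj : j ∉ R) (hn : Rᶜ.card ≤ n) {t : ℝ} (ht : 0 ≤ t) :
    ∫ J, ‖vec (proj j (E.evolved A R t J))‖ ^ 2 ∂E.couplingLaw ≤
      ‖vec A‖ ^ 2 * (Real.exp t * pathBound G i a n R j t) := by
  have := E.isProb
  have hprob : IsProbabilityMeasure E.couplingLaw := by unfold couplingLaw; infer_instance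
  have ha0 : 0 ≤ a := by rw [ha]; positivity
  induction n generalizing R j t with
  | zero =>
    have : j ∈ Rᶜ := Finset.mem_compl.2 hj
    have := Finset.card_pos.2 ⟨j, this⟩
    omega
  | succ n ih =>
    by_cases hij : j = i
    · -- At the site of the initial operator the empty path accounts for the trivial bound.
      have h1 : (1 : ℝ) ≤ pathBound G i a (n + 1) R j t := by
        unfold pathBound
        rw [Finset.sum_range_succ']
        simp [pathCount, hij]
      have h2 : ∫ J, ‖vec (proj j (E.evolved A R t J))‖ ^ 2 ∂E.couplingLaw ≤ ‖vec A‖ ^ 2 := by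
        calc ∫ J, ‖vec (proj j (E.evolved A R t J))‖ ^ 2 ∂E.couplingLaw
            ≤ ∫ _, ‖vec A‖ ^ 2 ∂E.couplingLaw := by
              refine integral_mono (E.integrable_norm_vec_proj_evolved_sq A R j t)
                (integrable_const _) fun J => ?_
              simp only
              rw [← E.norm_vec_evolved A R t J]
              exact pow_le_pow_left₀ (norm_nonneg _) (norm_vec_proj_le _ _) 2
          _ = ‖vec A‖ ^ 2 := by simp
      refine h2.trans (le_mul_of_one_le_right (sq_nonneg _) ?_)
      exact one_le_mul_of_one_le_of_one_le (Real.one_le_exp ht) h1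
    · have hAj : proj j A = 0 := by rw [hA.2 j, if_neg (by simpa using hij)]
      have hcard : (insert j R)ᶜ.card ≤ n := by
        have h1 : (insert j R)ᶜ = Rᶜ.erase j := by ext x; simp
        rw [h1, Finset.card_erase_of_mem (Finset.mem_compl.2 hj)]
        omega
      have hstep := E.lintegral_cumulativeInflux_le_of_forall hv hv0 hD hij hAj n
        (sq_nonneg ‖vec A‖) ha (fun x hxR hxj u hu => ih (R := insert j R) (j := x)
          (by simp [hxR, hxj]) hcard hu) ht
      have hle : ENNReal.ofReal (∫ J, ‖vec (proj j (E.evolved A R t J))‖ ^ 2 ∂E.couplingLaw) ≤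
          ENNReal.ofReal (‖vec A‖ ^ 2 * (Real.exp t * pathBound G i a (n + 1) R j t)) := by
        rw [ofReal_integral_eq_lintegral_ofReal (E.integrable_norm_vec_proj_evolved_sq A R j t)
          (Filter.Eventually.of_forall fun J => sq_nonneg _)]
        exact (lintegral_mono fun J =>
          E.norm_vec_proj_evolved_sq_le A hAj ht le_rfl J).trans hstep
      refine (ENNReal.ofReal_le_ofReal_iff ?_).1 hle
      exact mul_nonneg (sq_nonneg _) (mul_nonneg (Real.exp_pos _).le
        (pathBound_nonneg _ _ ha0 _ _ _ ht))

theorem lintegral_cumulativeInflux_le {v : ℝ} (hv : E.VarianceLE v) (hv0 : 0 ≤ v)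
    {D : ℕ} (hD : ∀ v, d v ≤ D) {A : Op d} {i j : Fin N} (hij : j ≠ i) (hA : IsLocalOn {i} A)
    {a : ℝ} (ha : a = v * ((2 * (D : ℝ) ^ q) ^ 2 * q)) {t : ℝ} (ht : 0 ≤ t) :
    ∫⁻ J, E.cumulativeInflux A ∅ j t J ∂E.couplingLaw ≤
      ENNReal.ofReal (‖vec A‖ ^ 2 * (Real.exp t * pathBound G i a (N + 1) ∅ j t)) := by
  have hAj : proj j A = 0 := by rw [hA.2 j, if_neg (by simpa using hij)]
  refine E.lintegral_cumulativeInflux_le_of_forall hv hv0 hD hij hAj N (sq_nonneg _) ha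
    (fun x hxR hxj u hu => E.integral_norm_vec_proj_evolved_sq_le hv hv0 hD hA ha N
      (by simpa using hxj) ?_ hu) ht
  exact (Finset.card_le_univ _).trans (by simp)

end SimpleEnsemble

/-! ### Averages over the factor graph -/

section GraphAverage

variable {q m : ℕ} {k : ℝ}

theorem factorProb_nonneg (hk : 0 ≤ k) : 0 ≤ factorProb N q m k := by
  unfold factorProb; positivity

theorem graphProb_nonneg (hk : 0 ≤ k) (hp : factorProb N q m k ≤ 1) (G : FactorGraph N q m) :
    0 ≤ graphProb k G := by
  refine Finset.prod_nonneg fun X _ => ?_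
  split_ifs
  · exact factorProb_nonneg hk
  · linarith

theorem graphExpect_mono (hk : 0 ≤ k) (hp : factorProb N q m k ≤ 1) {f g : FactorGraph N q m → ℝ}
    (h : ∀ G, f G ≤ g G) : graphExpect k f ≤ graphExpect k g :=
  Finset.sum_le_sum fun G _ => mul_le_mul_of_nonneg_left (h G) (graphProb_nonneg hk hp G)

theorem graphExpect_nonneg (hk : 0 ≤ k) (hp : factorProb N q m k ≤ 1) {f : FactorGraph N q m → ℝ}
    (h : ∀ G, 0 ≤ f G) : 0 ≤ graphExpect k f :=
  Finset.sum_nonneg fun G _ => mul_nonneg (graphProb_nonneg hk hp G) (h G)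

theorem graphExpect_const_mul (c : ℝ) (f : FactorGraph N q m → ℝ) :
    graphExpect k (fun G => c * f G) = c * graphExpect k f := by
  unfold graphExpect
  rw [Finset.mul_sum]
  exact Finset.sum_congr rfl fun G _ => by ring

theorem graphExpect_sum {α : Type*} (s : Finset α) (f : α → FactorGraph N q m → ℝ) :
    graphExpect k (fun G => ∑ a ∈ s, f a G) = ∑ a ∈ s, graphExpect k (f a) := by
  unfold graphExpect
  simp only [Finset.mul_sum]
  exact Finset.sum_comm

theorem graphExpect_one_sub (f : FactorGraph N q m → ℝ) :
    graphExpect k (fun G => 1 - f G) = 1 - graphExpect k f := by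
  have h := graphExpect_one (N := N) (q := q) (m := m) k
  unfold graphExpect at h ⊢
  simp only [mul_sub, Finset.sum_sub_distrib, h]

/-- The presence of a factor is independent of the functions that do not depend on it. -/
theorem graphExpect_ite_mem (X : Factor N q m) {f : FactorGraph N q m → ℝ}
    (hf : ∀ G, f (insert X G) = f G) :
    graphExpect k (fun G => if X ∈ G then f G else 0) = factorProb N q m k * graphExpect k f := by
  have huniv : (Finset.univ : Finset (FactorGraph N q m)) =
      (insert X (Finset.univ.erase X)).powerset := by
    rw [Finset.insert_erase (Finset.mem_univ X), Finset.powerset_univ]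
  have hX : X ∉ Finset.univ.erase X := Finset.notMem_erase X _
  unfold graphExpect
  rw [huniv, Finset.sum_powerset_insert hX, Finset.sum_powerset_insert hX,
    ← Finset.sum_add_distrib, ← Finset.sum_add_distrib, Finset.mul_sum]
  refine Finset.sum_congr rfl fun G hG => ?_
  have hXG : X ∉ G := fun h => hX (Finset.mem_powerset.1 hG h)
  set w := ∏ Y ∈ Finset.univ.erase X,
    if Y ∈ G then factorProb N q m k else 1 - factorProb N q m k
  have h1 : graphProb k G = (1 - factorProb N q m k) * w := by
    unfold graphProb
    rw [← Finset.mul_prod_erase _ _ (Finset.mem_univ X), if_neg hXG]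
  have h2 : graphProb k (insert X G) = factorProb N q m k * w := by
    unfold graphProb
    rw [← Finset.mul_prod_erase _ _ (Finset.mem_univ X), if_pos (Finset.mem_insert_self _ _)]
    congr 1
    refine Finset.prod_congr rfl fun Y hY => ?_
    simp [Finset.ne_of_mem_erase hY]
  simp only [h1, h2, hf, hXG, Finset.mem_insert_self, if_true, if_false]
  ring

theorem card_factor_le {j x : Fin N} (hjx : j ≠ x) (r : ℕ) :
    (Finset.univ.filter fun X : Factor N (r + 2) m => j ∈ X.1.1 ∧ x ∈ X.1.1).card ≤
      N.choose r * m := by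
  have hinj : (Finset.univ.filter fun X : Factor N (r + 2) m => j ∈ X.1.1 ∧ x ∈ X.1.1).card ≤
      (Finset.powersetCard r (Finset.univ : Finset (Fin N)) ×ˢ
        (Finset.univ : Finset (Fin m))).card := by
    refine Finset.card_le_card_of_injOn (fun X => ((X.1.1.erase j).erase x, X.2)) ?_ ?_
    · intro X hX
      obtain ⟨hj, hx⟩ := (Finset.mem_filter.1 hX).2
      have hx' : x ∈ X.1.1.erase j := Finset.mem_erase.2 ⟨hjx.symm, hx⟩
      simp [Finset.mem_powersetCard, Finset.card_erase_of_mem hx', Finset.card_erase_of_mem hj,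
        X.1.2]
    · intro X hX Y hY hXY
      obtain ⟨hj, hx⟩ := (Finset.mem_filter.1 hX).2
      obtain ⟨hj', hx'⟩ := (Finset.mem_filter.1 hY).2
      simp only [Prod.mk.injEq] at hXY
      have h : X.1.1 = Y.1.1 := by
        rw [← Finset.insert_erase hj, ← Finset.insert_erase hj',
          ← Finset.insert_erase (Finset.mem_erase.2 ⟨hjx.symm, hx⟩),
          ← Finset.insert_erase (Finset.mem_erase.2 ⟨hjx.symm, hx'⟩), hXY.1]
      exact Prod.ext (Subtype.ext h) hXY.2
  simpa using hinj

/-- The mean number of factors that contain two given sites. -/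
theorem factorProb_mul_card_le (hq : 1 ≤ q) (hm : 1 ≤ m) (hk : 0 ≤ k) {j x : Fin N}
    (hjx : j ≠ x) :
    factorProb N q m k *
      (Finset.univ.filter fun X : Factor N q m => j ∈ X.1.1 ∧ x ∈ X.1.1).card ≤
        ((q : ℝ) - 1) * k / N := by
  have hN : (0 : ℝ) < N := by exact_mod_cast j.pos
  have hm' : (0 : ℝ) < m := by exact_mod_cast hm
  obtain rfl | ⟨r, rfl⟩ : q = 1 ∨ ∃ r, q = r + 2 := by
    rcases Nat.lt_or_ge q 2 with h | h
    · exact Or.inl (by omega)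
    · exact Or.inr ⟨q - 2, by omega⟩
  · have h0 : (Finset.univ.filter fun X : Factor N 1 m => j ∈ X.1.1 ∧ x ∈ X.1.1) = ∅ := by
      refine Finset.filter_eq_empty_iff.2 fun X _ h => hjx ?_
      exact Finset.card_le_one.1 X.1.2.le _ h.1 _ h.2
    simp [h0]
  · have hcard : ((Finset.univ.filter fun X : Factor N (r + 2) m =>
        j ∈ X.1.1 ∧ x ∈ X.1.1).card : ℝ) ≤ (N : ℝ) ^ r / r.factorial * m := by
      refine (Nat.cast_le.2 (card_factor_le hjx r)).trans ?_
      rw [Nat.cast_mul]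
      gcongr
      exact Nat.choose_le_pow_div r N
    refine (mul_le_mul_of_nonneg_left hcard (factorProb_nonneg hk)).trans (le_of_eq ?_)
    have hr : (r.factorial : ℝ) ≠ 0 := by positivity
    unfold factorProb
    rw [show r + 2 - 1 = r + 1 by omega, Nat.factorial_succ]
    push_cast
    field_simp
    ring

/-- One step of a path, averaged over the presence of its factor. This factor contains the site that
the rest of the path avoids, and is therefore independent of it. -/
theorem graphExpect_pathCount_succ_le (hq : 1 ≤ q) (hm : 1 ≤ m) (hk : 0 ≤ k)
    (hp : factorProb N q m k ≤ 1) (i : Fin N) (l : ℕ) (R : Finset (Fin N)) (j : Fin N) :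
    graphExpect k (fun G : FactorGraph N q m => pathCount G i (l + 1) R j) ≤
      ((q : ℝ) - 1) * k / N *
        ∑ x, graphExpect k (fun G : FactorGraph N q m => pathCount G i l (insert j R) x) := by
  have hq' : (0 : ℝ) ≤ (q : ℝ) - 1 := by
    have : (1 : ℝ) ≤ q := by exact_mod_cast hq
    linarith
  have he0 : ∀ x, 0 ≤ graphExpect k (fun G : FactorGraph N q m => pathCount G i l (insert j R) x) :=
    fun x => graphExpect_nonneg hk hp fun G => pathCount_nonneg _ _ _ _ _
  by_cases hij : j = i
  · have h0 : ∀ G : FactorGraph N q m, pathCount G i (l + 1) R j = 0 := fun G => by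
      rw [pathCount, if_pos hij]
    simp only [h0]
    have : graphExpect k (fun _ : FactorGraph N q m => (0 : ℝ)) = 0 := by simp [graphExpect]
    rw [this]
    exact mul_nonneg (by positivity) (Finset.sum_nonneg fun x _ => he0 x)
  set e : Fin N → ℝ := fun x =>
    graphExpect k (fun G : FactorGraph N q m => pathCount G i l (insert j R) x) with he
  set p := factorProb N q m k with hpdef
  have hp0 : 0 ≤ p := factorProb_nonneg hk
  have h1 : ∀ G : FactorGraph N q m, pathCount G i (l + 1) R j =
      ∑ X ∈ Finset.univ.filter (fun X : Factor N q m => j ∈ X.1.1 ∧ Disjoint X.1.1 R),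
        if X ∈ G then ∑ x ∈ X.1.1.erase j, pathCount G i l (insert j R) x else 0 := by
    intro G
    rw [pathCount, if_neg hij, Finset.sum_ite, Finset.sum_const_zero, add_zero]
    refine Finset.sum_congr ?_ fun _ _ => rfl
    ext X
    simp [and_comm]
  have h2 : graphExpect k (fun G : FactorGraph N q m => pathCount G i (l + 1) R j) =
      ∑ X ∈ Finset.univ.filter (fun X : Factor N q m => j ∈ X.1.1 ∧ Disjoint X.1.1 R),
        p * ∑ x ∈ X.1.1.erase j, e x := by
    simp only [h1]
    rw [graphExpect_sum]
    refine Finset.sum_congr rfl fun X hX => ?_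
    have hXj : ¬ Disjoint X.1.1 (insert j R) := fun h =>
      Finset.disjoint_left.1 h (Finset.mem_filter.1 hX).2.1 (Finset.mem_insert_self _ _)
    rw [graphExpect_ite_mem X (fun G => by simp only [pathCount_insert G i l _ hXj]),
      graphExpect_sum]
  rw [h2]
  calc ∑ X ∈ Finset.univ.filter (fun X : Factor N q m => j ∈ X.1.1 ∧ Disjoint X.1.1 R),
        p * ∑ x ∈ X.1.1.erase j, e x
      ≤ ∑ X ∈ Finset.univ.filter (fun X : Factor N q m => j ∈ X.1.1),
        p * ∑ x ∈ X.1.1.erase j, e x := by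
        refine Finset.sum_le_sum_of_subset_of_nonneg (fun X hX => ?_) fun X _ _ =>
          mul_nonneg hp0 (Finset.sum_nonneg fun x _ => he0 x)
        simp only [Finset.mem_filter] at hX ⊢
        exact ⟨hX.1, hX.2.1⟩
    _ = ∑ x ∈ Finset.univ.erase j, (p * (Finset.univ.filter
          fun X : Factor N q m => j ∈ X.1.1 ∧ x ∈ X.1.1).card) * e x := by
        have hin : ∀ X : Factor N q m, ∑ x ∈ X.1.1.erase j, e x =
            ∑ x ∈ Finset.univ.erase j, if x ∈ X.1.1 then e x else 0 := by
          intro X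
          rw [← Finset.sum_filter]
          refine Finset.sum_congr ?_ fun _ _ => rfl
          ext x
          simp
        simp only [hin, Finset.mul_sum]
        rw [Finset.sum_comm]
        refine Finset.sum_congr rfl fun x _ => ?_
        simp only [← Finset.mul_sum]
        rw [mul_assoc, ← Finset.sum_filter, Finset.filter_filter, Finset.sum_const, nsmul_eq_mul]
    _ ≤ ∑ x ∈ Finset.univ.erase j, ((q : ℝ) - 1) * k / N * e x :=
        Finset.sum_le_sum fun x hx => mul_le_mul_of_nonneg_right
          (factorProb_mul_card_le hq hm hk (Finset.ne_of_mem_erase hx).symm) (he0 x)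
    _ ≤ ∑ x, ((q : ℝ) - 1) * k / N * e x :=
        Finset.sum_le_sum_of_subset_of_nonneg (Finset.subset_univ _) fun x _ _ =>
          mul_nonneg (by positivity) (he0 x)
    _ = _ := by rw [Finset.mul_sum]

theorem sum_graphExpect_pathCount_le (hq : 1 ≤ q) (hm : 1 ≤ m) (hk : 0 ≤ k)
    (hp : factorProb N q m k ≤ 1) (i : Fin N) (l : ℕ) (R : Finset (Fin N)) :
    ∑ x, graphExpect k (fun G : FactorGraph N q m => pathCount G i l R x) ≤
      (((q : ℝ) - 1) * k) ^ l := by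
  have hN : (0 : ℝ) < N := by exact_mod_cast i.pos
  have hq' : (0 : ℝ) ≤ (q : ℝ) - 1 := by
    have : (1 : ℝ) ≤ q := by exact_mod_cast hq
    linarith
  induction l generalizing R with
  | zero =>
    rw [← graphExpect_sum]
    simp [pathCount, graphExpect_one]
  | succ l ih =>
    calc ∑ x, graphExpect k (fun G : FactorGraph N q m => pathCount G i (l + 1) R x)
        ≤ ∑ _x : Fin N, ((q : ℝ) - 1) * k / N * (((q : ℝ) - 1) * k) ^ l :=
          Finset.sum_le_sum fun x _ => (graphExpect_pathCount_succ_le hq hm hk hp i l R x).trans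
            (mul_le_mul_of_nonneg_left (ih _) (by positivity))
      _ = (((q : ℝ) - 1) * k) ^ (l + 1) := by
          rw [Finset.sum_const, Finset.card_univ, Fintype.card_fin, nsmul_eq_mul, pow_succ]
          field_simp

/-- The mean path sum between two different sites is of the order `1 / N`. -/
theorem graphExpect_pathBound_le (hq : 1 ≤ q) (hm : 1 ≤ m) (hk : 0 ≤ k)
    (hp : factorProb N q m k ≤ 1) {i j : Fin N} (hij : j ≠ i) {a : ℝ} (ha : 0 ≤ a) (n : ℕ)
    (R : Finset (Fin N)) {t : ℝ} (ht : 0 ≤ t) :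
    graphExpect k (fun G : FactorGraph N q m => pathBound G i a n R j t) ≤
      Real.exp (a * (((q : ℝ) - 1) * k) * t) / N := by
  have hN : (0 : ℝ) < N := by exact_mod_cast i.pos
  have hq' : (0 : ℝ) ≤ (q : ℝ) - 1 := by
    have : (1 : ℝ) ≤ q := by exact_mod_cast hq
    linarith
  set γ := ((q : ℝ) - 1) * k with hγ
  have hγ0 : 0 ≤ γ := mul_nonneg hq' hk
  have hcount : ∀ l, graphExpect k (fun G : FactorGraph N q m => pathCount G i l R j) ≤
      γ ^ l / N := by
    intro l
    cases l with
    | zero =>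
      simp only [pathCount, if_neg hij]
      simp [graphExpect]
    | succ l =>
      refine (graphExpect_pathCount_succ_le hq hm hk hp i l R j).trans ?_
      refine (mul_le_mul_of_nonneg_left (sum_graphExpect_pathCount_le hq hm hk hp i l _)
        (by positivity)).trans (le_of_eq ?_)
      rw [pow_succ]
      ring
  unfold pathBound
  rw [graphExpect_sum]
  simp only [graphExpect_const_mul]
  calc ∑ l ∈ Finset.range n, a ^ l * t ^ l / (l.factorial : ℝ) *
        graphExpect k (fun G : FactorGraph N q m => pathCount G i l R j)
      ≤ ∑ l ∈ Finset.range n, a ^ l * t ^ l / (l.factorial : ℝ) * (γ ^ l / N) :=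
        Finset.sum_le_sum fun l _ => mul_le_mul_of_nonneg_left (hcount l) (by positivity)
    _ = (∑ l ∈ Finset.range n, (a * γ * t) ^ l / (l.factorial : ℝ)) / N := by
        rw [Finset.sum_div]
        refine Finset.sum_congr rfl fun l _ => ?_
        rw [mul_pow (a * γ) t, mul_pow a γ]
        ring
    _ ≤ _ := by
        gcongr
        exact Real.sum_le_exp_of_nonneg (by positivity) n

end GraphAverage

/-! ### Bounds for the spreading and the scrambling time -/

theorem opSpread_sq {H A : Op d} (hH : H.IsHermitian) (hA : A.IsHermitian) (hA0 : A ≠ 0)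
    (j : Fin N) (t : ℝ) :
    opSpread H A j t ^ 2 = ‖vec (proj j (evolve H t A))‖ ^ 2 / ‖vec A‖ ^ 2 := by
  have hne : Nonempty (Config d) := by
    by_contra h
    rw [not_nonempty_iff] at h
    exact hA0 (Subsingleton.elim _ _)
  have hcard : (Fintype.card (Config d) : ℝ) ≠ 0 := by
    exact_mod_cast Fintype.card_ne_zero
  rw [opSpread, opInner_proj j (isHermitian_evolve hH hA t), opInner_self hA,
    div_div_div_cancel_right₀ hcard, Real.sq_sqrt (by positivity)]

namespace SimpleEnsemble

variable {q m : ℕ} {G : FactorGraph N q m} (E : SimpleEnsemble d G)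

theorem opSpread_hamiltonian_sq {A : Op d} (hA : A.IsHermitian) (hA0 : A ≠ 0) (j : Fin N) (t : ℝ)
    (J : {X // X ∈ G} → ℝ) : opSpread (E.hamiltonian J) A j t ^ 2 =
      ‖vec (proj j (E.evolved A ∅ t J))‖ ^ 2 / ‖vec A‖ ^ 2 := by
  rw [opSpread_sq (E.isHermitian_hamiltonian J) hA hA0, evolved, cut_empty]

theorem integrable_opSpread_sq {A : Op d} (hA : A.IsHermitian) (hA0 : A ≠ 0) (j : Fin N)
    (t : ℝ) : Integrable (fun J => opSpread (E.hamiltonian J) A j t ^ 2) E.couplingLaw := by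
  simp only [E.opSpread_hamiltonian_sq hA hA0]
  exact (E.integrable_norm_vec_proj_evolved_sq A ∅ j t).div_const _

theorem integral_opSpread_sq_le {v : ℝ} (hv : E.VarianceLE v) (hv0 : 0 ≤ v) {D : ℕ}
    (hD : ∀ v, d v ≤ D) {A : Op d} {i : Fin N} (hA : IsLocalOn {i} A) (hA0 : A ≠ 0) (j : Fin N)
    {t : ℝ} (ht : 0 ≤ t) :
    ∫ J, opSpread (E.hamiltonian J) A j t ^ 2 ∂E.couplingLaw ≤
      Real.exp t * pathBound G i (v * ((2 * (D : ℝ) ^ q) ^ 2 * q)) N ∅ j t := by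
  have hpos : 0 < ‖vec A‖ := norm_pos_iff.2 (by simpa using hA0)
  simp only [E.opSpread_hamiltonian_sq hA.1 hA0]
  rw [integral_div, div_le_iff₀ (by positivity), mul_comm _ (‖vec A‖ ^ 2)]
  exact E.integral_norm_vec_proj_evolved_sq_le hv hv0 hD hA rfl N (by simp) (by simp) ht

/-- The scrambling time exceeds `τ` when the accumulated influx at time `τ` is small for one pair of
sites, because this influx bounds the spreading at all earlier times. -/
theorem le_scramblingTime {A : Fin N → Op d} {i j : Fin N} (hij : j ≠ i)
    (hA : IsLocalOn {i} (A i)) (hA0 : A i ≠ 0) {δ : ℝ} (hδ : 0 < δ) {τ : ℝ}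
    {J : {X // X ∈ G} → ℝ}
    (h : E.cumulativeInflux (A i) ∅ j τ J < ENNReal.ofReal (δ ^ 2 * ‖vec (A i)‖ ^ 2)) :
    ENNReal.ofReal τ ≤ scramblingTime (E.hamiltonian J) A δ := by
  have hAj : proj j (A i) = 0 := by rw [hA.2 j, if_neg (by simpa using hij)]
  have hpos : 0 < ‖vec (A i)‖ := norm_pos_iff.2 (by simpa using hA0)
  refine le_sInf ?_
  rintro _ ⟨t, -, rfl, hscr⟩
  refine ENNReal.ofReal_le_ofReal (le_of_not_gt fun htτ => ?_)
  obtain ⟨s, ⟨hs0, hst⟩, hs⟩ := hscr i j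
  have h1 : δ ^ 2 ≤ opSpread (E.hamiltonian J) (A i) j s ^ 2 := pow_le_pow_left₀ hδ.le hs 2
  rw [E.opSpread_hamiltonian_sq hA.1 hA0, le_div_iff₀ (by positivity)] at h1
  exact absurd ((ENNReal.ofReal_le_ofReal h1).trans
    (E.norm_vec_proj_evolved_sq_le (A i) hAj hs0 (hst.trans htτ.le) J)) (not_le.2 h)

/-- Markov's inequality for the cumulative influx. -/
theorem one_sub_le_real_scramblingTime {v : ℝ} (hv : E.VarianceLE v) (hv0 : 0 ≤ v) {D : ℕ}
    (hD : ∀ v, d v ≤ D) {A : Fin N → Op d} {i j : Fin N} (hij : j ≠ i)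
    (hA : IsLocalOn {i} (A i)) (hA0 : A i ≠ 0) {δ : ℝ} (hδ : 0 < δ) {τ : ℝ} (hτ : 0 ≤ τ) :
    1 - (δ ^ 2)⁻¹ * (Real.exp τ *
        pathBound G i (v * ((2 * (D : ℝ) ^ q) ^ 2 * q)) (N + 1) ∅ j τ) ≤
      E.couplingLaw.real
        {J | ENNReal.ofReal τ ≤ scramblingTime (E.hamiltonian J) A δ} := by
  have := E.isProb
  have hprob : IsProbabilityMeasure E.couplingLaw := by unfold couplingLaw; infer_instance
  have hpos : 0 < ‖vec (A i)‖ := norm_pos_iff.2 (by simpa using hA0)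
  set M := ‖vec (A i)‖ ^ 2 with hM
  have hM0 : 0 < M := by positivity
  set B := Real.exp τ * pathBound G i (v * ((2 * (D : ℝ) ^ q) ^ 2 * q)) (N + 1) ∅ j τ with hB
  have hB0 : 0 ≤ B := mul_nonneg (Real.exp_pos _).le
    (pathBound_nonneg _ _ (by positivity) _ _ _ hτ)
  set bad := {J | ENNReal.ofReal (δ ^ 2 * M) ≤ E.cumulativeInflux (A i) ∅ j τ J} with hbad
  have hmeas : MeasurableSet bad :=
    measurableSet_le measurable_const (E.measurable_cumulativeInflux (A i) ∅ j τ)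
  have hε : 0 < δ ^ 2 * M := by positivity
  have hmarkov : E.couplingLaw bad ≤ ENNReal.ofReal ((δ ^ 2)⁻¹ * B) := by
    have hdiv : (δ ^ 2)⁻¹ * B = M * B / (δ ^ 2 * M) := by field_simp
    rw [hdiv, ENNReal.ofReal_div_of_pos hε]
    refine (meas_ge_le_lintegral_div (E.measurable_cumulativeInflux (A i) ∅ j τ).aemeasurable
      (by simpa using hε) ENNReal.ofReal_ne_top).trans ?_
    gcongr
    exact E.lintegral_cumulativeInflux_le hv hv0 hD hij hA rfl hτ
  have hreal : E.couplingLaw.real bad ≤ (δ ^ 2)⁻¹ * B :=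
    ENNReal.toReal_le_of_le_ofReal (by positivity) hmarkov
  calc 1 - (δ ^ 2)⁻¹ * B ≤ 1 - E.couplingLaw.real bad := by linarith
    _ = E.couplingLaw.real badᶜ := (probReal_compl_eq_one_sub hmeas).symm
    _ ≤ _ := measureReal_mono fun J hJ =>
        E.le_scramblingTime hij hA hA0 hδ (not_le.1 hJ)

end SimpleEnsemble

/-- The mean of the bound on the spreading grows exponentially, at a rate that depends neither on
the size of the system nor on its mean degree. -/
theorem graphExpect_exp_mul_pathBound_le {q m Q D : ℕ} {k 𝒥 : ℝ} (hq : 1 ≤ q) (hqQ : q ≤ Q)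
    (hD : 1 ≤ D) (hm : 1 ≤ m) (hk : 0 < k) (hp : factorProb N q m k ≤ 1) {i j : Fin N}
    (hij : j ≠ i) (n : ℕ) {t : ℝ} (ht : 0 ≤ t) :
    graphExpect k (fun G : FactorGraph N q m => Real.exp t *
      pathBound G i (𝒥 ^ 2 / (q * k) * ((2 * (D : ℝ) ^ q) ^ 2 * q)) n ∅ j t) ≤
      Real.exp ((1 + (2 * (D : ℝ) ^ Q) ^ 2 * 𝒥 ^ 2 * Q) * t) / N := by
  have hN : (0 : ℝ) < N := by exact_mod_cast i.pos
  have hq0 : (0 : ℝ) < q := by exact_mod_cast hq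
  have hD' : (1 : ℝ) ≤ D := by exact_mod_cast hD
  have hqQ' : (q : ℝ) - 1 ≤ Q := by
    have : (q : ℝ) ≤ Q := by exact_mod_cast hqQ
    linarith
  have hrate : 𝒥 ^ 2 / (q * k) * ((2 * (D : ℝ) ^ q) ^ 2 * q) * (((q : ℝ) - 1) * k) ≤
      (2 * (D : ℝ) ^ Q) ^ 2 * 𝒥 ^ 2 * Q := by
    have h1 : 𝒥 ^ 2 / (q * k) * ((2 * (D : ℝ) ^ q) ^ 2 * q) * (((q : ℝ) - 1) * k) =
        (2 * (D : ℝ) ^ q) ^ 2 * 𝒥 ^ 2 * ((q : ℝ) - 1) := by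
      field_simp
    rw [h1]
    have hq1 : (0 : ℝ) ≤ (q : ℝ) - 1 := by
      have : (1 : ℝ) ≤ q := by exact_mod_cast hq
      linarith
    gcongr
  rw [graphExpect_const_mul, add_mul, one_mul, Real.exp_add, mul_div_assoc]
  refine mul_le_mul_of_nonneg_left ?_ (Real.exp_pos _).le
  refine (graphExpect_pathBound_le hq hm hk.le hp hij (by positivity) n ∅ ht).trans ?_
  gcongr

end Scrambling

theorem mainTheorem4 (Q D : ℕ) (𝒥 : ℝ) (h𝒥 : 0 < 𝒥) :
    ∃ c₁ c₂ c₃ c₄ κ : ℝ, 0 < c₁ ∧ 0 < c₂ ∧ 0 < c₃ ∧ 0 < c₄ ∧ 0 < κ ∧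
      (∀ (N q m : ℕ) (k : ℝ) (d : Fin N → ℕ), 1 ≤ q → q ≤ Q → 1 ≤ m → 0 < k →
        Scrambling.factorProb N q m k ≤ 1 → (∀ v, 2 ≤ d v ∧ d v ≤ D) →
        ∀ E : (G : Scrambling.FactorGraph N q m) → Scrambling.SimpleEnsemble d G,
        (∀ G, (E G).VarianceLE (𝒥 ^ 2 / (q * k))) →
        ∀ (i j : Fin N) (A : Scrambling.Op d), i ≠ j → Scrambling.IsLocalOn {i} A → A ≠ 0 →
        ∀ t : ℝ, 0 ≤ t →
          (∀ G, MeasureTheory.Integrable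
            (fun J => Scrambling.opSpread ((E G).hamiltonian J) A j t ^ 2) (E G).couplingLaw) ∧
          Scrambling.graphExpect k (fun G =>
              ∫ J, Scrambling.opSpread ((E G).hamiltonian J) A j t ^ 2 ∂(E G).couplingLaw)
            ≤ c₁ / N * Real.exp (c₂ * t) + c₃ / (N : ℝ) ^ 2 * Real.exp (c₄ * t ^ 2)) ∧
      (∀ δ : ℝ, 0 < δ → δ ≤ 1 → ∀ ε : ℝ, 0 < ε → ∃ N₀ : ℕ,
        ∀ (N q m : ℕ) (k : ℝ) (d : Fin N → ℕ), N₀ ≤ N → 1 ≤ q → q ≤ Q → 1 ≤ m → 0 < k →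
        Scrambling.factorProb N q m k ≤ 1 → (∀ v, 2 ≤ d v ∧ d v ≤ D) →
        ∀ E : (G : Scrambling.FactorGraph N q m) → Scrambling.SimpleEnsemble d G,
        (∀ G, (E G).VarianceLE (𝒥 ^ 2 / (q * k))) →
        ∀ A : Fin N → Scrambling.Op d,
        (∀ v, Scrambling.IsLocalOn {v} (A v) ∧ A v ≠ 0) →
          1 - ε ≤ Scrambling.graphExpect k (fun G =>
            (E G).couplingLaw.real {J | ENNReal.ofReal (κ * Real.sqrt (Real.log N)) ≤
              Scrambling.scramblingTime ((E G).hamiltonian J) A δ})) := by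
  open Scrambling in
  set c : ℝ := 1 + (2 * (D : ℝ) ^ Q) ^ 2 * 𝒥 ^ 2 * Q with hc
  have hc0 : 0 < c := by positivity
  -- The choice of `κ` makes the bound `exp (c τ) / N` at most `1 / √N` at `τ = κ √(log N)`.
  refine ⟨1, c, 1, 1, (2 * c)⁻¹, one_pos, hc0, one_pos, one_pos, by positivity, ?_, ?_⟩
  · intro N q m k d hq hqQ hm hk hp hd E hE i j A hij hA hA0 t ht
    have hD : 1 ≤ D := by have := hd i; omega
    refine ⟨fun G => (E G).integrable_opSpread_sq hA.1 hA0 j t, ?_⟩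
    have h1 := (graphExpect_mono hk.le hp fun G => (E G).integral_opSpread_sq_le (hE G)
      (by positivity) (fun v => (hd v).2) hA hA0 j ht).trans
      (graphExpect_exp_mul_pathBound_le (Q := Q) hq hqQ hD hm hk hp hij.symm N ht)
    refine h1.trans ?_
    rw [one_div_mul_eq_div]
    exact le_add_of_nonneg_right (by positivity)
  · intro δ hδ _ ε hε
    obtain ⟨n, hn⟩ := exists_nat_ge (((δ ^ 2)⁻¹ * ε⁻¹) ^ 2)
    refine ⟨max n 3, fun N q m k d hN hq hqQ hm hk hp hd E hE A hA => ?_⟩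
    have hN3 : 3 ≤ N := (le_max_right _ _).trans hN
    have hN3' : (3 : ℝ) ≤ N := by exact_mod_cast hN3
    have hN0 : (0 : ℝ) < N := by linarith
    have hnN : (n : ℝ) ≤ N := by exact_mod_cast (le_max_left n 3).trans hN
    let i : Fin N := ⟨0, by omega⟩
    let j : Fin N := ⟨1, by omega⟩
    have hij : j ≠ i := by simp [i, j, Fin.ext_iff]
    have hD : 1 ≤ D := by have := hd i; omega
    set τ : ℝ := (2 * c)⁻¹ * Real.sqrt (Real.log N) with hτ
    have hτ0 : 0 ≤ τ := by positivity
    have h1 := graphExpect_mono hk.le hp fun G => (E G).one_sub_le_real_scramblingTime (hE G)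
      (by positivity) (fun v => (hd v).2) hij (hA i).1 (hA i).2 hδ hτ0
    refine le_trans ?_ h1
    rw [graphExpect_one_sub, graphExpect_const_mul]
    have h2 := graphExpect_exp_mul_pathBound_le (Q := Q) (𝒥 := 𝒥) hq hqQ hD hm hk hp hij (N + 1) hτ0
    have hlog : 1 ≤ Real.log N := by
      rw [Real.le_log_iff_exp_le hN0]
      linarith [Real.exp_one_lt_d9]
    have hexp : Real.exp (c * τ) ≤ Real.sqrt N := by
      have h3 : c * τ = Real.sqrt (Real.log N) / 2 := by
        rw [hτ]; field_simp
      have h4 : Real.sqrt (Real.log N) ≤ Real.log N :=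
        Real.sqrt_le_iff.2 ⟨by linarith, by nlinarith⟩
      rw [h3, ← Real.exp_log (Real.sqrt_pos.2 hN0), Real.log_sqrt hN0.le]
      gcongr
    have hsqrt : (δ ^ 2)⁻¹ * ε⁻¹ ≤ Real.sqrt N := Real.le_sqrt_of_sq_le (hn.trans hnN)
    have hbound : (δ ^ 2)⁻¹ * (Real.exp (c * τ) / N) ≤ ε := by
      calc (δ ^ 2)⁻¹ * (Real.exp (c * τ) / N) ≤ (δ ^ 2)⁻¹ * (Real.sqrt N / N) := by gcongr
        _ = ((δ ^ 2)⁻¹ * ε⁻¹) * ε / Real.sqrt N := by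
            rw [Real.sqrt_div_self']
            field_simp
        _ ≤ Real.sqrt N * ε / Real.sqrt N := by gcongr
        _ = ε := by
            have : Real.sqrt N ≠ 0 := (Real.sqrt_pos.2 hN0).ne'
            field_simp
    have h5 := mul_le_mul_of_nonneg_left h2 (by positivity : 0 ≤ (δ ^ 2)⁻¹)
    linarith
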